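/- Let $G$ be a finite (discrete) group. "Spaces" are compactly generated weakly Hausdorff spaces. A $G$-operad $\mathcal O$ is a symmetric operad in $G$-spaces, so that each $\mathcal O(n)$, $n\ge 0$, is a $(G\times\Sigma_n)$-space. It is an $N_\infty$ operad if each $\Sigma_n$ acts freely on $\mathcal O(n)$, if for all $n\ge 0$ and all subgroups $\Lambda\le G\times\Sigma_n$ the fixed point space $\mathcal O(n)^\Lambda$ is either empty or contractible, and if $\mathcal O(n)^{H\times\{e\}}\neq\varnothing$ for all $n\ge 0$ and all subgroups $H\le G$. Morphisms of $N_\infty$ operads are the maps of $G$-operads; such a map $f:\mathcal O\to\mathcal O'$ is a weak equivalence if $f_n:\mathcal O(n)^\Lambda\to\mathcal O'(n)^\Lambda$ is a weak homotopy equivalence for all $n\ge0$ and all $\Lambda\le G\times\Sigma_n$. Let $\mathrm{Ho}(N_\infty\text{-}\mathbf{Op})$ be the localization of the category of $N_\infty$ operads at the weak equivalences. For a subgroup $H\le G$, a finite $H$-set $T$ is an admissible set of $\mathcal O$ if, for some ordering $T\cong\{1,\dots,n\}$ with associated permutation representation $\alpha:H\to\Sigma_n$, one has $\mathcal O(n)^{\Lambda}\neq\varnothing$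 for $\Lambda=\{(h,\alpha(h)) : h\in H\}$. Let $\mathbb A(\mathcal O)(H)$ be the class of admissible finite $H$-sets of $\mathcal O$. An indexing system $\mathcal F$ assigns to every subgroup $H\le G$ a class $\mathcal F(H)$ of finite $H$-sets that contains all finite $H$-sets with trivial action, such that these classes are closed under isomorphism, restriction ($T\in\mathcal F(H)$ and $K\le H$ imply $\mathrm{res}^H_KT\in\mathcal F(K)$), conjugation ($T\in\mathcal F(H)$ and $a\in G$ imply $aT\in\mathcal F(aHa^{-1})$), subobjects, finite coproducts, and self-induction ($K\le H$, $T\in\mathcal F(K)$ and $H/K\in\mathcal F(H)$ imply $H\times_KT\in\mathcal F(H)$). Let $\mathbf{Ind}$ be the poset of indexing systems ordered by levelwise inclusion, regarded as a category. Then $\mathcal O\mapsto\mathbb A(\mathcal O)$ defines a functor from the category of $N_\infty$ operads to $\mathbf{Ind}$ that sends weak equivalences to isomorphisms, and the induced functor $$\mathbb A:\mathrm{Ho}(N_\infty\text{-}\mathbf{Op})\to\mathbf{Ind}$$ is an equivalence of categories. -/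

import Mathlib

open CategoryTheory
open scoped Topology

universe u

namespace NInfinity

/-! ### Finite `H`-sets, coefficient systems and indexing systems -/

section IndexingSystems

variable {G : Type u} [Group G]

/-- The conjugate `gT` of an `H`-set `T`: the set `T` on which `g h g⁻¹ ∈ g H g⁻¹` acts
as `h` does. -/
@[reducible] noncomputable def conjAction {H : Subgroup G} {T : Type u} (g : G)
    (a : MulAction H T) : MulAction (H.map (MulAut.conj g).toMonoidHom) T :=
  letI := a
  MulAction.compHom T
    (H.equivMapOfInjective (MulAut.conj g).toMonoidHom (MulAut.conj g).injective).symm.toMonoidHom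

/-- The restriction of an `H`-set to a subgroup `K ≤ H`. -/
@[reducible] def resAction {K H : Subgroup G} (hKH : K ≤ H) {T : Type u}
    (a : MulAction H T) : MulAction K T :=
  letI := a
  MulAction.compHom T (Subgroup.inclusion hKH)

/-- The relation `(h k, t) ∼ (h, k t)` for `k ∈ K` on `H × T`. -/
def indSetoid {K H : Subgroup G} (hKH : K ≤ H) (T : Type u) [MulAction K T] :
    Setoid (H × T) where
  r p q := ∃ k : K, p.1 = q.1 * Subgroup.inclusion hKH k ∧ q.2 = k • p.2
  iseqv :=
    { refl := fun p => ⟨1, by simp⟩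
      symm := by
        rintro ⟨h, t⟩ ⟨h', t'⟩ ⟨k, h1, h2⟩
        refine ⟨k⁻¹, ?_, ?_⟩ <;> simp_all
      trans := by
        rintro ⟨h, t⟩ ⟨h', t'⟩ ⟨h'', t''⟩ ⟨k, h1, h2⟩ ⟨l, h3, h4⟩
        refine ⟨l * k, ?_, ?_⟩ <;> simp_all [mul_smul, mul_assoc] }

/-- The induced `H`-set `ind_K^H T = H ×_K T`. -/
def Induced {K H : Subgroup G} (hKH : K ≤ H) (T : Type u) [MulAction K T] : Type u :=
  Quotient (indSetoid hKH T)

instance {K H : Subgroup G} (hKH : K ≤ H) (T : Type u) [MulAction K T] :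
    MulAction H (Induced hKH T) where
  smul h := Quotient.map (sa := indSetoid hKH T) (sb := indSetoid hKH T)
    (fun p => (h * p.1, p.2)) (by
      rintro p q ⟨k, h1, h2⟩
      exact ⟨k, by simp [h1, mul_assoc], h2⟩)
  one_smul x := by
    induction x using Quotient.inductionOn with
    | h p => exact congrArg (Quotient.mk (indSetoid hKH T)) (Prod.ext (one_mul p.1) rfl)
  mul_smul h h' x := by
    induction x using Quotient.inductionOn with
    | h p => exact congrArg (Quotient.mk (indSetoid hKH T)) (Prod.ext (mul_assoc h h' p.1) rfl)

variable (G)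

/-- A coefficient system: for every subgroup `H` of `G`, a class of finite `H`-sets, which contains
the trivial actions and is closed under isomorphism, restriction and conjugation. -/
@[ext] structure CoefficientSystem where
  /-- `mem H T a` says that the set `T` with the `H`-action `a` belongs to the `H`-component. -/
  mem : ∀ (H : Subgroup G) (T : Type u), MulAction H T → Prop
  finite : ∀ (H : Subgroup G) (T : Type u) (a : MulAction H T), mem H T a → Finite T
  trivial_mem : ∀ (H : Subgroup G) (T : Type u) (a : MulAction H T), Finite T →
    (∀ (h : H) (t : T), h • t = t) → mem H T a
  iso_mem : ∀ (H : Subgroup G) (S T : Type u) (a : MulAction H S) (b : MulAction H T) (e : S ≃ T),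
    (∀ (h : H) (s : S), e (h • s) = h • e s) → mem H S a → mem H T b
  res_mem : ∀ (K H : Subgroup G) (hKH : K ≤ H) (T : Type u) (a : MulAction H T),
    mem H T a → mem K T (resAction hKH a)
  conj_mem : ∀ (H : Subgroup G) (T : Type u) (a : MulAction H T) (g : G),
    mem H T a → mem (H.map (MulAut.conj g).toMonoidHom) T (conjAction g a)

/-- An indexing system: a coefficient system closed under subobjects, finite coproducts and
self-induction. -/
structure IndexingSystem extends CoefficientSystem G where
  sub_mem : ∀ (H : Subgroup G) (S T : Type u) (a : MulAction H S) (b : MulAction H T) (f : S → T),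
    Function.Injective f → (∀ (h : H) (s : S), f (h • s) = h • f s) → mem H T b → mem H S a
  coprod_mem : ∀ (H : Subgroup G) (ι : Type u) (T : ι → Type u) (a : ∀ i, MulAction H (T i)),
    Finite ι → (∀ i, mem H (T i) (a i)) → mem H (Σ i, T i) inferInstance
  ind_mem : ∀ (K H : Subgroup G) (hKH : K ≤ H) (T : Type u) (a : MulAction K T),
    mem K T a → mem H (H ⧸ K.subgroupOf H) inferInstance → mem H (Induced hKH T) inferInstance

/-- Coefficient systems are ordered by levelwise inclusion. -/
instance : PartialOrder (CoefficientSystem G) where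
  le C D := ∀ (H : Subgroup G) (T : Type u) (a : MulAction H T), C.mem H T a → D.mem H T a
  le_refl _ _ _ _ h := h
  le_trans _ _ _ h h' H T a x := h' H T a (h H T a x)
  le_antisymm C D h h' := by
    ext H T a
    exact ⟨h H T a, h' H T a⟩

/-- The poset of indexing systems, ordered by levelwise inclusion. -/
instance : PartialOrder (IndexingSystem G) :=
  PartialOrder.lift IndexingSystem.toCoefficientSystem (by
    rintro ⟨C, _, _, _⟩ ⟨D, _, _, _⟩ h
    cases h
    rfl)

end IndexingSystems

/-! ### Spaces and weak homotopy equivalences -/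

/-- A space is weakly Hausdorff if the image of every continuous map to it from a compact Hausdorff
space is closed. -/
class WeaklyHausdorffSpace (X : Type u) [TopologicalSpace X] : Prop where
  isClosed_range : ∀ (K : Type u) [TopologicalSpace K] [CompactSpace K] [T2Space K] (f : K → X),
    Continuous f → IsClosed (Set.range f)

section WeakEquivalence

variable {X Y : Type u} [TopologicalSpace X] [TopologicalSpace Y]

/-- The map on path components induced by a continuous map. -/
def zerothHomotopyMap (f : C(X, Y)) : ZerothHomotopy X → ZerothHomotopy Y :=
  Quotient.map f (fun _ _ h => Nonempty.map (fun p : Path _ _ => p.map f.continuous) h)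

/-- The map on generalized loops induced by a continuous map. -/
def genLoopMap (n : ℕ) (f : C(X, Y)) (x : X) (g : GenLoop (Fin n) X x) :
    GenLoop (Fin n) Y (f x) :=
  ⟨f.comp g.1, fun y hy => congrArg f (g.2 y hy)⟩

/-- The map `π_n(X, x) → π_n(Y, f x)` induced by a continuous map. -/
def homotopyGroupMap (n : ℕ) (f : C(X, Y)) (x : X) :
    HomotopyGroup.Pi n X x → HomotopyGroup.Pi n Y (f x) :=
  Quotient.map (genLoopMap n f x) (fun _ _ h => h.comp_continuousMap f)

/-- A weak homotopy equivalence: a map inducing bijections on path components and on all homotopy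
groups at all basepoints. -/
def IsWeakHomotopyEquiv (f : C(X, Y)) : Prop :=
  Function.Bijective (zerothHomotopyMap f) ∧
    ∀ (n : ℕ) (x : X), Function.Bijective (homotopyGroupMap n f x)

end WeakEquivalence

/-! ### Operads in `G`-spaces -/

/-- If the symmetric groups act on the terms of a sequence `O`, then a bijection
`e : {1, …, m} ≃ {1, …, n}` (so that `m = n`) acts as a map `O m → O n`: the identification of
`O m` with `O n`, followed by the permutation corresponding to `e`. -/
def relabel (G : Type u) [Group G] (O : ℕ → Type u)
    [∀ n, MulAction (G × Equiv.Perm (Fin n)) (O n)] {m n : ℕ} (e : Fin m ≃ Fin n) (x : O m) : O n :=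
  have h : m = n := Fin.equiv_iff_eq.mp ⟨e⟩
  ((1 : G), (finCongr h).symm.trans e) • (h ▸ x : O n)

/-- The permutation of `j 1 + ⋯ + j k` letters which permutes the `k` blocks as `σ` does:
the block number `i` of the source, of length `j (σ i)`, is carried in order to the block number
`σ i` of the target. -/
def blockPerm {k : ℕ} (σ : Equiv.Perm (Fin k)) (j : Fin k → ℕ) :
    Fin (∑ i, j (σ i)) ≃ Fin (∑ i, j i) :=
  finSigmaFinEquiv.symm.trans
    ((Equiv.sigmaCongrLeft (β := fun i => Fin (j i)) σ).trans finSigmaFinEquiv)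

/-- The block sum `τ 1 ⊕ ⋯ ⊕ τ k` of permutations. -/
def blockSum {k : ℕ} {j : Fin k → ℕ} (τ : ∀ i, Equiv.Perm (Fin (j i))) :
    Equiv.Perm (Fin (∑ i, j i)) :=
  finSigmaFinEquiv.permCongr (Equiv.sigmaCongrRight τ)

/-- A (symmetric) operad in `G`-spaces, where spaces are compactly generated and weakly
Hausdorff. The symmetric groups act from the left; `σ • x` is `x` with its input number `i`
renumbered as input number `σ i`. -/
structure GOperad (G : Type u) [Group G] where
  obj : ℕ → Type u
  [top : ∀ n, TopologicalSpace (obj n)]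
  [compactlyGenerated : ∀ n, CompactlyGeneratedSpace (obj n)]
  [weaklyHausdorff : ∀ n, WeaklyHausdorffSpace (obj n)]
  [act : ∀ n, MulAction (G × Equiv.Perm (Fin n)) (obj n)]
  [continuous_act : ∀ n, ContinuousConstSMul (G × Equiv.Perm (Fin n)) (obj n)]
  /-- the identity operation -/
  one : obj 1
  /-- operadic composition -/
  comp : ∀ {k : ℕ} {j : Fin k → ℕ}, obj k → (∀ i, obj (j i)) → obj (∑ i, j i)
  /-- Composition is continuous on the product in the category of compactly generated spaces. -/
  continuous_comp : ∀ {k : ℕ} {j : Fin k → ℕ},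
    Continuous[TopologicalSpace.compactlyGenerated.{u} (obj k × ∀ i, obj (j i)), top (∑ i, j i)]
      (fun p : obj k × ∀ i, obj (j i) => comp p.1 p.2)
  one_comp : ∀ {j : Fin 1 → ℕ} (y : ∀ i, obj (j i)),
    (⟨∑ i, j i, comp one y⟩ : Σ n, obj n) = ⟨j 0, y 0⟩
  comp_one : ∀ {k : ℕ} (x : obj k),
    (⟨∑ _ : Fin k, 1, comp x (fun _ => one)⟩ : Σ n, obj n) = ⟨k, x⟩
  assoc : ∀ {k : ℕ} {j : Fin k → ℕ} {m : ∀ i, Fin (j i) → ℕ}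
    (x : obj k) (y : ∀ i, obj (j i)) (z : ∀ i l, obj (m i l)),
    (⟨_, comp (comp x y)
        (fun a => z (finSigmaFinEquiv.symm a).1 (finSigmaFinEquiv.symm a).2)⟩ : Σ n, obj n) =
      ⟨_, comp x (fun i => comp (y i) (z i))⟩
  perm_comp : ∀ {k : ℕ} {j : Fin k → ℕ} (σ : Equiv.Perm (Fin k)) (x : obj k)
    (y : ∀ i, obj (j i)),
    comp (((1 : G), σ) • x) y = relabel G obj (blockPerm σ j) (comp x (fun i => y (σ i)))
  comp_perm : ∀ {k : ℕ} {j : Fin k → ℕ} (τ : ∀ i, Equiv.Perm (Fin (j i))) (x : obj k)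
    (y : ∀ i, obj (j i)),
    comp x (fun i => ((1 : G), τ i) • y i) = ((1 : G), blockSum τ) • comp x y
  smul_one : ∀ g : G, (g, (1 : Equiv.Perm (Fin 1))) • one = one
  smul_comp : ∀ {k : ℕ} {j : Fin k → ℕ} (g : G) (x : obj k) (y : ∀ i, obj (j i)),
    (g, (1 : Equiv.Perm (Fin (∑ i, j i)))) • comp x y =
      comp ((g, (1 : Equiv.Perm (Fin k))) • x)
        (fun i => (g, (1 : Equiv.Perm (Fin (j i)))) • y i)

attribute [instance] GOperad.top GOperad.compactlyGenerated GOperad.weaklyHausdorff GOperad.act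
  GOperad.continuous_act

section Operads

variable {G : Type u} [Group G]

/-- A map of operads in `G`-spaces. -/
@[ext] structure GOperad.Hom (O P : GOperad G) where
  app : ∀ n, O.obj n → P.obj n
  continuous_app : ∀ n, Continuous (app n)
  map_smul : ∀ (n : ℕ) (g : G × Equiv.Perm (Fin n)) (x : O.obj n), app n (g • x) = g • app n x
  map_one : app 1 O.one = P.one
  map_comp : ∀ {k : ℕ} {j : Fin k → ℕ} (x : O.obj k) (y : ∀ i, O.obj (j i)),
    app _ (O.comp x y) = P.comp (app k x) (fun i => app (j i) (y i))

instance : Category (GOperad G) where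
  Hom := GOperad.Hom
  id O := ⟨fun _ x => x, fun _ => continuous_id, fun _ _ _ => rfl, rfl, fun _ _ => rfl⟩
  comp f g :=
    ⟨fun n x => g.app n (f.app n x), fun n => (g.continuous_app n).comp (f.continuous_app n),
      fun n a x => by rw [f.map_smul, g.map_smul], by rw [f.map_one, g.map_one],
      fun x y => by rw [f.map_comp, g.map_comp]⟩

/-- The map on `Λ`-fixed points induced by a map of operads, for `Λ ≤ G × Σ_n`. -/
def GOperad.Hom.fixedMap {O P : GOperad G} (f : O.Hom P) (n : ℕ)
    (Λ : Subgroup (G × Equiv.Perm (Fin n))) :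
    C(MulAction.fixedPoints Λ (O.obj n), MulAction.fixedPoints Λ (P.obj n)) where
  toFun x := ⟨f.app n x.1, fun l =>
    (f.map_smul n (l : G × Equiv.Perm (Fin n)) x.1).symm.trans (congrArg (f.app n) (x.2 l))⟩
  continuous_toFun := ((f.continuous_app n).comp continuous_subtype_val).subtype_mk _

variable (G)

/-- `N_∞` operads: the symmetric groups act freely, all fixed point subspaces are empty or
contractible, and those of the subgroups `H × {e}` are not empty. -/
structure IsNInfinity (O : GOperad G) : Prop where
  free : ∀ (n : ℕ) (σ : Equiv.Perm (Fin n)) (x : O.obj n), ((1 : G), σ) • x = x → σ = 1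
  empty_or_contractible : ∀ (n : ℕ) (Λ : Subgroup (G × Equiv.Perm (Fin n))),
    IsEmpty (MulAction.fixedPoints Λ (O.obj n)) ∨
      ContractibleSpace (MulAction.fixedPoints Λ (O.obj n))
  nonempty : ∀ (n : ℕ) (H : Subgroup G),
    (MulAction.fixedPoints (H.prod (⊥ : Subgroup (Equiv.Perm (Fin n)))) (O.obj n)).Nonempty

/-- The category of `N_∞` operads, a full subcategory of the category of operads in
`G`-spaces. -/
abbrev NInfOperad : Type (u + 1) :=
  ObjectProperty.FullSubcategory (fun O : GOperad G => IsNInfinity G O)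

/-- Weak equivalences of operads in `G`-spaces: the maps `f` such that every `f n` is a weak
equivalence of `(G × Σ_n)`-spaces. -/
def operadWeakEquivalences : MorphismProperty (GOperad G) := fun _ _ f =>
  ∀ (n : ℕ) (Λ : Subgroup (G × Equiv.Perm (Fin n))),
    IsWeakHomotopyEquiv (GOperad.Hom.fixedMap f n Λ)

/-- Weak equivalences of `N_∞` operads. -/
def weakEquivalences : MorphismProperty (NInfOperad G) :=
  (operadWeakEquivalences G).inverseImage (ObjectProperty.ι _)

/-- The homotopy category of `N_∞` operads: the localization at the weak equivalences. -/
abbrev HoNInfOperad : Type (u + 1) := (weakEquivalences G).Localization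

variable {G}

/-- The permutation representation `α : H → Σ_n` of an `H`-set `T` ordered by
`e : T ≃ {1, …, n}`. -/
def permRep {H : Subgroup G} {T : Type u} [MulAction H T] {n : ℕ} (e : T ≃ Fin n) :
    H →* Equiv.Perm (Fin n) :=
  e.permCongrHom.toMonoidHom.comp (MulAction.toPermHom H T)

/-- The subgroup `{(h, α h) | h ∈ H}` of `G × Σ_n`. -/
def graphSubgroup {H : Subgroup G} {n : ℕ} (α : H →* Equiv.Perm (Fin n)) :
    Subgroup (G × Equiv.Perm (Fin n)) :=
  (H.subtype.prod α).range

/-- The `H`-set `T` (with the action `a`) is finite and an admissible set of the operad `O`: under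
some ordering of `T`, with associated permutation representation `α`, the fixed points of
`{(h, α h) | h ∈ H}` in `O |T|` are not empty. -/
def IsAdmissible (O : GOperad G) (H : Subgroup G) (T : Type u) (a : MulAction H T) : Prop :=
  letI := a
  ∃ (n : ℕ) (e : T ≃ Fin n),
    (MulAction.fixedPoints (graphSubgroup (permRep (H := H) e)) (O.obj n)).Nonempty

end Operads

end NInfinity

/-!
The functor `admissibleFunctor` sends an `N_∞` operad to its admissible sets. That they form an
indexing system rests on one closure property, closure under extensions: if `p : T → S` is a map
of finite `H`-sets, `S` is admissible and so are the fibres of `p`, as sets with actions of the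
stabilizers, then `T` is admissible. For operads this is operadic composition
(`isClosedUnderExtensions_isAdmissible`). For coefficient systems it is equivalent to being an
indexing system (`CoefficientSystem.toIndexingSystem`,
`IndexingSystem.isClosedUnderExtensions`).

*Full faithfulness.* The category of `N_∞` operads has binary products. By freeness, a subgroup of
`G × Σ_n` with fixed points in `O n` is the graph of a permutation representation, hence has fixed
points in `P n` if `A(O) ≤ A(P)`; as fixed point spaces are empty or contractible, the projection
`O × P → O` is then a weak equivalence (`weakEquivalences_fst`). This forces the localization to be
thin: its morphisms `O → P` are all equal to the inverse of `O × P → O` followed by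
`O × P → P` (`WeakProducts.eq_canon`). In particular, two maps `f, g : O → P` become equal, since
both projections `P × P → P` become inverse to the diagonal.

*Essential surjectivity.* Let `F` be an indexing system. Its sets are the input sets of the operation
symbols of an equivariant signature, which generates a free operad of planar trees in `G`-sets. A
tree invariant under `H` has as its `H`-set of leaves an iterated extension of sets of inputs, so
that the admissible sets of the free operad are those of `F` (`mem_of_isAdmissible_operad`,
`IndexingSystem.isAdmissible_operad`). Finally, a set `X` is replaced by the space of functions
`[0, 1) → X` which are locally constant from the right, with the topology of convergence in
measure. This construction preserves products, commutes with fixed points and turns nonempty sets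
into contractible spaces, so it turns the free operad into an `N_∞` operad with the same
admissible sets (`isNInfinity_stepFun`, `isAdmissible_stepFun_iff`).
-/

namespace NInfinity

/-! ### Products of compactly generated weakly Hausdorff spaces -/

section CompactlyGenerated

open unitInterval

variable {X Y Z W : Type u} [TopologicalSpace X] [TopologicalSpace Y] [TopologicalSpace Z]
  [TopologicalSpace W]

/-- A compact image in a weakly Hausdorff space is Hausdorff: it is a `T1` quotient of a compact
Hausdorff, hence normal, space by a closed map. -/
lemma t2Space_range [WeaklyHausdorffSpace X] {K : Type u} [TopologicalSpace K] [CompactSpace K]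
    [T2Space K] {f : K → X} (hf : Continuous f) : T2Space (Set.range f) := by
  have hclosed (s : Set K) (hs : IsClosed s) : IsClosed (f '' s) := by
    have : CompactSpace s := isCompact_iff_compactSpace.mp hs.isCompact
    have := WeaklyHausdorffSpace.isClosed_range s (fun x => f x) (hf.comp continuous_subtype_val)
    rwa [Set.image_eq_range]
  have hpt (k : K) : IsClosed {f k} := by
    simpa using hclosed {k} isClosed_singleton
  refine ⟨?_⟩
  rintro ⟨_, a, rfl⟩ ⟨_, b, rfl⟩ hab
  have hab : f a ≠ f b := fun h => hab (Subtype.ext h)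
  obtain ⟨U, V, hU, hV, haU, hbV, hUV⟩ := NormalSpace.normal (f ⁻¹' {f a}) (f ⁻¹' {f b})
    ((hpt a).preimage hf) ((hpt b).preimage hf)
    (Set.disjoint_left.mpr fun x hx hy => hab (hx.symm.trans hy))
  refine ⟨Subtype.val ⁻¹' (f '' Uᶜ)ᶜ, Subtype.val ⁻¹' (f '' Vᶜ)ᶜ,
    (hclosed _ hU.isClosed_compl).isOpen_compl.preimage continuous_subtype_val,
    (hclosed _ hV.isClosed_compl).isOpen_compl.preimage continuous_subtype_val, ?_, ?_, ?_⟩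
  · rintro ⟨x, hx, h⟩
    exact hx (haU h)
  · rintro ⟨x, hx, h⟩
    exact hx (hbV h)
  · rw [Set.disjoint_left]
    rintro ⟨_, x, rfl⟩ hx hy
    have hxU : x ∈ U := by_contra fun h => hx ⟨x, h, rfl⟩
    have hxV : x ∈ V := by_contra fun h => hy ⟨x, h, rfl⟩
    exact Set.disjoint_left.mp hUV hxU hxV

instance [WeaklyHausdorffSpace X] [WeaklyHausdorffSpace Y] : WeaklyHausdorffSpace (X × Y) where
  isClosed_range K _ _ _ f hf := by
    have h1 : Continuous fun k => (f k).1 := continuous_fst.comp hf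
    have h2 : Continuous fun k => (f k).2 := continuous_snd.comp hf
    have := t2Space_range h1
    have := t2Space_range h2
    let A := Set.range fun k => (f k).1
    let B := Set.range fun k => (f k).2
    -- The image of `f` is compact in the Hausdorff space `A × B`, which is closed in `X × Y`.
    let q : K → A × B := fun k => (⟨_, k, rfl⟩, ⟨_, k, rfl⟩)
    have hq : Continuous q := by fun_prop
    have hA : IsClosed A := WeaklyHausdorffSpace.isClosed_range K _ h1
    have hB : IsClosed B := WeaklyHausdorffSpace.isClosed_range K _ h2
    have hj := hA.isClosedEmbedding_subtypeVal.prodMap hB.isClosedEmbedding_subtypeVal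
    have := hj.isClosedMap _ (isCompact_range hq).isClosed
    rwa [← Set.range_comp] at this

lemma isClosed_eqLocus [CompactlyGeneratedSpace X] [WeaklyHausdorffSpace Y] {f g : X → Y}
    (hf : Continuous f) (hg : Continuous g) : IsClosed {x | f x = g x} := by
  refine CompactlyGeneratedSpace.isClosed' fun K _ _ _ r hr => ?_
  let s : K ⊕ K → Y := Sum.elim (f ∘ r) (g ∘ r)
  have := t2Space_range (f := s) (by fun_prop)
  have h1 : Continuous fun k : K => (⟨f (r k), Sum.inl k, rfl⟩ : Set.range s) := by fun_prop
  have h2 : Continuous fun k : K => (⟨g (r k), Sum.inr k, rfl⟩ : Set.range s) := by fun_prop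
  convert isClosed_eq h1 h2 using 1
  ext k
  exact ⟨fun h => Subtype.ext h, fun h => congrArg Subtype.val h⟩

lemma compactlyGeneratedSpace_of_isClosed_subtype [CompactlyGeneratedSpace X] {s : Set X}
    (hs : IsClosed s) : CompactlyGeneratedSpace s := by
  refine compactlyGeneratedSpace_of_isClosed fun t ht => ?_
  have : IsClosed (Subtype.val '' t : Set X) := by
    refine CompactlyGeneratedSpace.isClosed' fun K _ _ _ r hr => ?_
    have hc : IsClosed (r ⁻¹' s) := hs.preimage hr
    have : CompactSpace (r ⁻¹' s) := isCompact_iff_compactSpace.mp hc.isCompact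
    have h := ht (r ⁻¹' s) (fun k => ⟨r k.1, k.2⟩)
      ((hr.comp continuous_subtype_val).subtype_mk _)
    convert hc.isClosedEmbedding_subtypeVal.isClosedMap _ h using 1
    ext k
    simp
  convert this.preimage continuous_subtype_val using 1
  rw [Set.preimage_image_eq _ Subtype.val_injective]

/-- Continuity on `I × Z`, where `Z` is compactly generated, can be tested on the products of `I`
with compact Hausdorff spaces: as `I` is locally compact, continuity on `I × Z` means
continuity of the adjoint map from `Z` to the path space. -/
lemma continuous_unitInterval_prod [CompactlyGeneratedSpace Z] (f : I × Z → W)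
    (hf : ∀ (K : Type u) [TopologicalSpace K] [CompactSpace K] [T2Space K] (r : K → Z),
      Continuous r → Continuous fun p : I × K => f (p.1, r p.2)) : Continuous f := by
  have h1 (z : Z) : Continuous fun t => f (t, z) :=
    (hf PUnit (fun _ => z) continuous_const).comp
      (by fun_prop : Continuous fun t : I => (t, PUnit.unit))
  let F : Z → C(I, W) := fun z => ⟨fun t => f (t, z), h1 z⟩
  have hF : Continuous F := by
    refine continuous_from_compactlyGeneratedSpace F fun K _ _ _ r hr => ?_
    refine ContinuousMap.continuous_of_continuous_uncurry _ ?_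
    exact (hf K r hr).comp continuous_swap
  exact (continuous_eval.comp
    ((hF.comp continuous_snd).prodMk continuous_fst) : Continuous fun p : I × Z => F p.2 p.1)

lemma continuous_compactlyGenerated_of_compact {K : Type u} [TopologicalSpace K] [CompactSpace K]
    [T2Space K] {f : K → X} (hf : Continuous f) :
    Continuous[inferInstance, TopologicalSpace.compactlyGenerated.{u} X] f := by
  let T := Σ i : (S : CompHaus.{u}) × C(S, X), i.fst
  let i : (S : CompHaus.{u}) × C(S, X) := ⟨CompHaus.of K, ⟨f, hf⟩⟩
  have h : Continuous (fun k : K => (⟨i, k⟩ : T)) :=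
    @continuous_sigmaMk _ (fun i : (S : CompHaus.{u}) × C(S, X) => i.fst) _ i
  have h' := continuous_coinduced_rng (t := instTopologicalSpaceSigma) (f := fun p : T => p.1.2 p.2)
  exact @Continuous.comp K T X _ instTopologicalSpaceSigma
    (TopologicalSpace.compactlyGenerated.{u} X) (fun k => ⟨i, k⟩) (fun p => p.1.2 p.2) h' h

lemma continuous_to_compactlyGenerated [CompactlyGeneratedSpace Z] {f : Z → X}
    (hf : Continuous f) :
    Continuous[inferInstance, TopologicalSpace.compactlyGenerated.{u} X] f :=
  @continuous_from_compactlyGeneratedSpace Z X _ (TopologicalSpace.compactlyGenerated.{u} X)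
    _ f fun _ _ _ _ _ hr => continuous_compactlyGenerated_of_compact (hf.comp hr)

lemma compactlyGenerated_le : TopologicalSpace.compactlyGenerated.{u} X ≤ ‹TopologicalSpace X› :=
  continuous_id_iff_le.mp (continuous_from_compactlyGenerated _ fun _ g => g.continuous)

/-- The product of two spaces in the category of compactly generated spaces. -/
def KProd (X Y : Type u) : Type u := X × Y

namespace KProd

/-- The point of the product with given coordinates. -/
def mk {X Y : Type u} (x : X) (y : Y) : KProd X Y := (x, y)

instance : TopologicalSpace (KProd X Y) := TopologicalSpace.compactlyGenerated.{u} (X × Y)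

lemma continuous_fst : Continuous (fun p : KProd X Y => p.1) :=
  continuous_le_dom compactlyGenerated_le _root_.continuous_fst

lemma continuous_snd : Continuous (fun p : KProd X Y => p.2) :=
  continuous_le_dom compactlyGenerated_le _root_.continuous_snd

lemma continuous_mk [CompactlyGeneratedSpace Z] {f : Z → X} {g : Z → Y} (hf : Continuous f)
    (hg : Continuous g) : Continuous fun z => KProd.mk (f z) (g z) :=
  continuous_to_compactlyGenerated (X := X × Y) (hf.prodMk hg)

instance : CompactlyGeneratedSpace (KProd X Y) :=
  compactlyGeneratedSpace_of_continuous_maps fun _ h =>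
    continuous_from_compactlyGenerated (X := X × Y) _ fun S g =>
      h S g (continuous_compactlyGenerated_of_compact (X := X × Y) (f := g) g.continuous)

instance [WeaklyHausdorffSpace X] [WeaklyHausdorffSpace Y] : WeaklyHausdorffSpace (KProd X Y) where
  isClosed_range K _ _ _ f hf :=
    (WeaklyHausdorffSpace.isClosed_range (X := X × Y) K f
      (continuous_le_rng compactlyGenerated_le hf)).mono compactlyGenerated_le

end KProd

/-- If `s ⊆ X` and `t ⊆ Y` are contractible, then so is a closed subspace `c` of the product of `X`
and `Y` in compactly generated spaces which has the points of `s × t`. -/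
lemma KProd.contractibleSpace {s : Set X} {t : Set Y} [ContractibleSpace s] [ContractibleSpace t]
    {c : Set (KProd X Y)} (hc : IsClosed c) (h : ∀ p, p ∈ c ↔ p.1 ∈ s ∧ p.2 ∈ t) :
    ContractibleSpace c := by
  have := compactlyGeneratedSpace_of_isClosed_subtype hc
  obtain ⟨a, ⟨F⟩⟩ := id_nullhomotopic s
  obtain ⟨b, ⟨F'⟩⟩ := id_nullhomotopic t
  rw [contractible_iff_id_nullhomotopic]
  let p1 : c → s := fun z => ⟨z.1.1, ((h z.1).mp z.2).1⟩
  let p2 : c → t := fun z => ⟨z.1.2, ((h z.1).mp z.2).2⟩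
  have hp1 : Continuous p1 := (KProd.continuous_fst.comp continuous_subtype_val).subtype_mk _
  have hp2 : Continuous p2 := (KProd.continuous_snd.comp continuous_subtype_val).subtype_mk _
  let Φ : I × c → c := fun z => ⟨KProd.mk (F (z.1, p1 z.2)).1 (F' (z.1, p2 z.2)).1,
    (h _).mpr ⟨Subtype.prop _, Subtype.prop _⟩⟩
  have hΦ : Continuous Φ := by
    refine continuous_unitInterval_prod Φ fun K _ _ _ r hr => ?_
    refine Continuous.subtype_mk (KProd.continuous_mk ?_ ?_) _
    · have := hp1.comp hr
      fun_prop
    · have := hp2.comp hr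
      fun_prop
  refine ⟨⟨KProd.mk a.1 b.1, (h _).mpr ⟨a.2, b.2⟩⟩, ⟨⟨⟨Φ, hΦ⟩, fun z => ?_, fun z => ?_⟩⟩⟩
  · refine Subtype.ext ?_
    change KProd.mk (F (0, p1 z)).1 (F' (0, p2 z)).1 = z.1
    rw [F.apply_zero, F'.apply_zero]
    rfl
  · refine Subtype.ext ?_
    change KProd.mk (F (1, p1 z)).1 (F' (1, p2 z)).1 = _
    rw [F.apply_one, F'.apply_one]
    rfl

end CompactlyGenerated

/-! ### Maps of contractible spaces are weak equivalences -/

section HomotopyGroups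

open unitInterval

/-- The piecewise linear map of the unit interval that stretches `[1/4, 3/4]` to `[0, 1]`. -/
noncomputable def stretch (t : I) : I := Set.projIcc 0 1 zero_le_one (2 * (t : ℝ) - 1 / 2)

lemma continuous_stretch : Continuous stretch :=
  continuous_projIcc.comp (by fun_prop)

lemma stretch_zero : stretch 0 = 0 := by
  refine Set.projIcc_of_le_left _ ?_
  norm_num

lemma stretch_one : stretch 1 = 1 := by
  refine Set.projIcc_of_right_le _ ?_
  norm_num

/-- A bump function on the unit interval, equal to `1` where `stretch` is not `0` or `1`. -/
noncomputable def bump (t : I) : I :=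
  Set.projIcc 0 1 zero_le_one (4 * min (t : ℝ) (1 - t))

lemma continuous_bump : Continuous bump :=
  continuous_projIcc.comp (by fun_prop)

lemma bump_zero : bump 0 = 0 := by
  refine Set.projIcc_of_le_left _ ?_
  norm_num

lemma bump_one : bump 1 = 0 := by
  refine Set.projIcc_of_le_left _ ?_
  norm_num

lemma bump_eq_one_or (t : I) : bump t = 1 ∨ stretch t = 0 ∨ stretch t = 1 := by
  by_cases h1 : (t : ℝ) ≤ 1 / 4
  · right; left
    refine Set.projIcc_of_le_left _ ?_
    linarith
  by_cases h2 : 3 / 4 ≤ (t : ℝ)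
  · right; right
    refine Set.projIcc_of_right_le _ ?_
    linarith
  · left
    refine Set.projIcc_of_right_le _ ?_
    have : 1 / 4 ≤ min (t : ℝ) (1 - t) := le_min (by linarith) (by linarith)
    linarith

variable {X : Type u} [TopologicalSpace X]

/-- Every generalized loop in a contractible space is nullhomotopic relative to the boundary.
A contraction moves the base point along a path `γ`. The loop is first made constant near the
boundary of the cube, and then contracted with a speed that vanishes on the boundary. What
remains factors through `γ`, and is contracted along `γ`. -/
lemma genLoop_homotopic_const [ContractibleSpace X] {n : ℕ} {x : X} (g : GenLoop (Fin n) X x) :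
    GenLoop.Homotopic g GenLoop.const := by
  obtain ⟨c, ⟨F⟩⟩ := id_nullhomotopic X
  have hb (y : Fin n → I) (hy : y ∈ Cube.boundary (Fin n)) : ∏ i, bump (y i) = 0 := by
    obtain ⟨i, h | h⟩ := hy
    · exact Finset.prod_eq_zero (Finset.mem_univ i) (by rw [h, bump_zero])
    · exact Finset.prod_eq_zero (Finset.mem_univ i) (by rw [h, bump_one])
  have cb : Continuous fun y : Fin n → I => ∏ i, bump (y i) :=
    continuous_finsetProd _ fun i _ => continuous_bump.comp (continuous_apply i)
  have cs : Continuous fun y : Fin n → I => fun i => stretch (y i) :=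
    continuous_pi fun i => continuous_stretch.comp (continuous_apply i)
  have hsb (y : Fin n → I) (hy : y ∈ Cube.boundary (Fin n)) :
      (fun i => stretch (y i)) ∈ Cube.boundary (Fin n) := by
    obtain ⟨i, h | h⟩ := hy
    · exact ⟨i, Or.inl (by simp only [h, stretch_zero])⟩
    · exact ⟨i, Or.inr (by simp only [h, stretch_one])⟩
  let g₁ : GenLoop (Fin n) X x :=
    ⟨⟨fun y => g fun i => stretch (y i), g.1.continuous.comp cs⟩, fun y hy => g.2 _ (hsb y hy)⟩
  let g₂ : GenLoop (Fin n) X x :=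
    ⟨⟨fun y => F (∏ i, bump (y i), x), F.continuous.comp (by fun_prop)⟩, fun y hy => by
      change F (∏ i, bump (y i), x) = x
      rw [hb y hy, F.apply_zero]; rfl⟩
  have h₁ : GenLoop.Homotopic g g₁ := by
    let lin : I × (Fin n → I) → (Fin n → I) := fun p i =>
      ⟨(1 - (p.1 : ℝ)) * p.2 i + p.1 * stretch (p.2 i), by
        have h0 := p.1.2.1; have h1 := p.1.2.2
        have h2 := (p.2 i).2.1; have h3 := (p.2 i).2.2
        have h4 := (stretch (p.2 i)).2.1; have h5 := (stretch (p.2 i)).2.2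
        constructor
        · have := mul_nonneg (sub_nonneg.mpr h1) h2
          have := mul_nonneg h0 h4
          linarith
        · have := mul_nonneg (sub_nonneg.mpr h1) (sub_nonneg.mpr h3)
          have := mul_nonneg h0 (sub_nonneg.mpr h5)
          linarith⟩
    have hlin : Continuous lin := by
      refine continuous_pi fun i => Continuous.subtype_mk ?_ _
      have := continuous_stretch.comp
        ((continuous_apply i).comp (continuous_snd (X := I) (Y := Fin n → I)))
      fun_prop
    refine ⟨⟨⟨⟨fun p => g (lin p), g.1.continuous.comp hlin⟩, fun y => ?_, fun y => ?_⟩,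
      fun t y hy => ?_⟩⟩
    · change g _ = g y
      congr 1
      funext i
      ext
      simp [lin]
    · change g _ = g _
      congr 1
      funext i
      ext
      simp [lin]
    · change g (lin (t, y)) = g y
      refine Eq.trans (g.2 _ ?_) (g.2 y hy).symm
      obtain ⟨i, h | h⟩ := hy
      · exact ⟨i, Or.inl (by ext; simp [lin, h, stretch_zero])⟩
      · exact ⟨i, Or.inr (by ext; simp [lin, h, stretch_one])⟩
  have h₂ : GenLoop.Homotopic g₁ g₂ := by
    refine ⟨⟨⟨⟨fun p => F (p.1 * ∏ i, bump (p.2 i), g₁ p.2), F.continuous.comp ?_⟩,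
      fun y => ?_, fun y => ?_⟩, fun t y hy => ?_⟩⟩
    · have := g₁.1.continuous.comp (continuous_snd (X := I) (Y := Fin n → I))
      exact (continuous_fst.mul (cb.comp continuous_snd)).prodMk this
    · change F (0 * _, g₁ y) = g₁ y
      rw [zero_mul, F.apply_zero]; rfl
    · change F (1 * _, g₁ y) = F (_, x)
      rw [one_mul]
      by_cases h : ∀ i, bump (y i) = 1
      · rw [Finset.prod_eq_one fun i _ => h i, F.apply_one, F.apply_one]; rfl
      · push Not at h
        obtain ⟨i, hi⟩ := h
        have : g₁ y = x := g.2 _ ⟨i, (bump_eq_one_or (y i)).resolve_left hi⟩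
        rw [this]
    · change F (t * _, g₁ y) = g₁ y
      rw [hb y hy, mul_zero, F.apply_zero]; rfl
  have h₃ : GenLoop.Homotopic g₂ GenLoop.const := by
    refine ⟨⟨⟨⟨fun p => F (σ p.1 * ∏ i, bump (p.2 i), x), F.continuous.comp ?_⟩,
      fun y => ?_, fun y => ?_⟩, fun t y hy => ?_⟩⟩
    · have := cb.comp (continuous_snd (X := I) (Y := Fin n → I))
      have h : Continuous fun p : I × (Fin n → I) => σ p.1 * ∏ i, bump (p.2 i) :=
        (continuous_symm.comp continuous_fst).mul this
      exact h.prodMk continuous_const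
    · change F (σ 0 * _, x) = F (_, x)
      rw [symm_zero, one_mul]
    · change F (σ 1 * _, x) = x
      rw [symm_one, zero_mul, F.apply_zero]; rfl
    · change F (σ t * _, x) = F (_, x)
      rw [hb y hy, mul_zero]
  exact h₁.trans (h₂.trans h₃)

instance [ContractibleSpace X] (n : ℕ) (x : X) : Subsingleton (HomotopyGroup.Pi n X x) where
  allEq a b := by
    induction a, b using Quotient.inductionOn₂ with
    | h a b => exact Quotient.sound ((genLoop_homotopic_const a).trans
        (genLoop_homotopic_const b).symm)

lemma isWeakHomotopyEquiv_of_contractible {Y : Type u} [TopologicalSpace Y] [ContractibleSpace X]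
    [ContractibleSpace Y] (f : C(X, Y)) : IsWeakHomotopyEquiv f := by
  have (Z : Type u) [TopologicalSpace Z] [ContractibleSpace Z] :
      Subsingleton (ZerothHomotopy Z) ∧ Nonempty (ZerothHomotopy Z) := by
    obtain ⟨h1, h2⟩ := pathConnectedSpace_iff_zerothHomotopy.mp
      (inferInstance : PathConnectedSpace Z)
    exact ⟨h2, h1⟩
  obtain ⟨_, _⟩ := this X
  obtain ⟨_, h⟩ := this Y
  refine ⟨⟨Function.injective_of_subsingleton _, fun y => ?_⟩, fun n x =>
    ⟨Function.injective_of_subsingleton _, fun y => ?_⟩⟩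
  · exact ⟨Classical.arbitrary _, Subsingleton.elim _ _⟩
  · exact ⟨Quotient.mk _ GenLoop.const, Subsingleton.elim _ _⟩

lemma isWeakHomotopyEquiv_of_isEmpty {Y : Type u} [TopologicalSpace Y] [IsEmpty Y]
    (f : C(X, Y)) : IsWeakHomotopyEquiv f := by
  have : IsEmpty X := ⟨fun x => isEmptyElim (f x)⟩
  have (Z : Type u) [TopologicalSpace Z] [IsEmpty Z] : IsEmpty (ZerothHomotopy Z) :=
    ⟨fun z => Quotient.inductionOn z fun z => isEmptyElim z⟩
  have hX := this X
  have hY := this Y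
  exact ⟨⟨Function.injective_of_subsingleton _, fun y => isEmptyElim y⟩, fun n x => isEmptyElim x⟩

lemma IsWeakHomotopyEquiv.nonempty {Y : Type u} [TopologicalSpace Y] {f : C(X, Y)}
    (hf : IsWeakHomotopyEquiv f) (h : Nonempty Y) : Nonempty X := by
  obtain ⟨y⟩ := h
  obtain ⟨x, _⟩ := hf.1.2 (Quotient.mk _ y)
  induction x using Quotient.inductionOn with
  | h x => exact ⟨x⟩

end HomotopyGroups

/-! ### Localizations equivalent to posets -/

section Localization

universe v w

variable {C : Type w} [Category.{v} C] {D : Type*} [PartialOrder D] {W : MorphismProperty C}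

/-- Binary products which need not be unique: every two objects `X`, `Y` have a cone `X ← Z → Y`
through which all other cones factor. -/
structure WeakProducts (C : Type w) [Category.{v} C] where
  prod : C → C → C
  fst : ∀ X Y, prod X Y ⟶ X
  snd : ∀ X Y, prod X Y ⟶ Y
  lift : ∀ {T X Y : C} (_ : T ⟶ X) (_ : T ⟶ Y), T ⟶ prod X Y
  lift_fst : ∀ {T X Y : C} (a : T ⟶ X) (b : T ⟶ Y), lift a b ≫ fst X Y = a
  lift_snd : ∀ {T X Y : C} (a : T ⟶ X) (b : T ⟶ Y), lift a b ≫ snd X Y = b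

namespace WeakProducts

variable (p : WeakProducts C) (A : C ⥤ D)
  (hp : ∀ X Y, A.obj X ≤ A.obj Y → W (p.fst X Y))

/-- The canonical morphism `X → Y` of the localization: the inverse of the first projection of
`X × Y`, followed by the second projection. -/
noncomputable def canon (X Y : C) (h : A.obj X ≤ A.obj Y) : W.Q.obj X ⟶ W.Q.obj Y :=
  (Localization.Construction.wIso (p.fst X Y) (hp X Y h)).inv ≫ W.Q.map (p.snd X Y)

include hp

/-- The legs of every cone `X ← T → Y` are related by the canonical morphism. This is the only
property of it that matters below. -/
lemma map_canon {T X Y : C} (h : A.obj X ≤ A.obj Y) (a : T ⟶ X) (b : T ⟶ Y) :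
    W.Q.map a ≫ p.canon A hp X Y h = W.Q.map b := by
  have h1 : W.Q.map a = W.Q.map (p.lift a b) ≫
      (Localization.Construction.wIso (p.fst X Y) (hp X Y h)).hom := by
    change _ = W.Q.map (p.lift a b) ≫ W.Q.map _
    rw [← Functor.map_comp, p.lift_fst]
  rw [h1, canon, Category.assoc, Iso.hom_inv_id_assoc, ← Functor.map_comp, p.lift_snd]

/-- A morphism of `C` becomes canonical in the localization. -/
lemma map_eq_canon {X Y : C} (f : X ⟶ Y) :
    W.Q.map f = p.canon A hp X Y (leOfHom (A.map f)) := by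
  rw [← p.map_canon A hp (leOfHom (A.map f)) (𝟙 X) f, CategoryTheory.Functor.map_id,
    Category.id_comp]

lemma canon_comp {X Y Z : C} (h : A.obj X ≤ A.obj Y) (h' : A.obj Y ≤ A.obj Z) :
    p.canon A hp X Y h ≫ p.canon A hp Y Z h' = p.canon A hp X Z (h.trans h') := by
  -- The projection of `(X × Y) × Z` to `X` is an isomorphism in the localization, and both sides
  -- become the projection of `(X × Y) × Z` to `Z` after precomposition with it.
  have hZ : A.obj (p.prod X Y) ≤ A.obj Z := (leOfHom (A.map (p.fst X Y))).trans (h.trans h')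
  let i := Localization.Construction.wIso (p.fst (p.prod X Y) Z) (hp _ _ hZ)
  let j := Localization.Construction.wIso (p.fst X Y) (hp _ _ h)
  have hij : (i ≪≫ j).hom = W.Q.map (p.fst (p.prod X Y) Z ≫ p.fst X Y) :=
    (W.Q.map_comp _ _).symm
  rw [← cancel_epi (i ≪≫ j).hom, hij, p.map_canon A hp _ _ (p.snd (p.prod X Y) Z),
    ← Category.assoc, p.map_canon A hp _ _ (p.fst (p.prod X Y) Z ≫ p.snd X Y),
    p.map_canon A hp _ _ (p.snd (p.prod X Y) Z)]

/-- A formal inverse is canonical in the localization. -/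
lemma wInv_eq_canon (hA : W.IsInvertedBy A) {X Y : C} (w : X ⟶ Y) (hw : W w) :
    Localization.Construction.wInv w hw =
      p.canon A hp Y X (leOfHom (@inv _ _ _ _ (A.map w) (hA w hw))) := by
  rw [← cancel_epi (Localization.Construction.wIso w hw).hom, Iso.hom_inv_id]
  have h : (Localization.Construction.wIso w hw).hom = W.Q.map w := rfl
  rw [h, p.map_canon A hp _ w (𝟙 X), CategoryTheory.Functor.map_id]

/-- All morphisms of the localization are canonical. -/
lemma eq_canon (hA : W.IsInvertedBy A) (X Y : C) (f : W.Q.obj X ⟶ W.Q.obj Y) :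
    ∃ h : A.obj X ≤ A.obj Y, f = p.canon A hp X Y h := by
  let P : MorphismProperty W.Localization := fun X Y f =>
    ∃ h : A.obj X.as.obj ≤ A.obj Y.as.obj, f = p.canon A hp X.as.obj Y.as.obj h
  have : P.IsStableUnderComposition := ⟨fun f g ⟨h, hf⟩ ⟨h', hg⟩ =>
    ⟨h.trans h', by rw [hf, hg]; exact p.canon_comp A hp h h'⟩⟩
  have hP : P = ⊤ := Localization.Construction.morphismProperty_eq_top P
    (fun X Y f => ⟨leOfHom (A.map f), p.map_eq_canon A hp f⟩)
    (fun X Y w hw => ⟨_, p.wInv_eq_canon A hp hA w hw⟩)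
  have : P f := by rw [hP]; trivial
  exact this

/-- If a functor `A` to a poset inverts `W` and is surjective, and if the projection
`X × Y → X` belongs to `W` whenever `A X ≤ A Y`, then `A` exhibits the poset as the localization
at `W`. -/
lemma isEquivalence_lift (hA : W.IsInvertedBy A) (hsurj : Function.Surjective A.obj) :
    (Localization.Construction.lift A hA).IsEquivalence where
  faithful := ⟨fun {X Y} f g _ => by
    obtain ⟨_, hf⟩ := p.eq_canon A hp hA X.as.obj Y.as.obj f
    obtain ⟨_, hg⟩ := p.eq_canon A hp hA X.as.obj Y.as.obj g
    exact hf.trans hg.symm⟩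
  full := ⟨fun {X Y} f => ⟨p.canon A hp X.as.obj Y.as.obj (leOfHom f), Subsingleton.elim _ _⟩⟩
  essSurj := ⟨fun d => by
    obtain ⟨X, rfl⟩ := hsurj d
    exact ⟨W.Q.obj X, ⟨Iso.refl _⟩⟩⟩

end WeakProducts
end Localization

/-! ### Closure under extensions -/

section Fibrations

variable {G : Type u} [Group G]

/-- `Y`, with the action of the subgroup `K` of `G`, is the fibre over `s` of the map of `H`-sets
`p : T → S`, embedded by `f`: the group `K` is the stabilizer of `s`, and `f` is an equivariant
bijection from `Y` to `p ⁻¹ {s}`. -/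
structure IsFibre {H : Subgroup G} {T S : Type u} [MulAction H T] [MulAction H S] (p : T → S)
    (s : S) (K : Subgroup G) (hK : K ≤ H) (Y : Type u) [MulAction K Y] (f : Y → T) : Prop where
  smul_eq_iff : ∀ h : H, h • s = s ↔ (h : G) ∈ K
  injective : Function.Injective f
  range_eq : Set.range f = p ⁻¹' {s}
  map_smul : ∀ (k : K) (y : Y), f (k • y) = Subgroup.inclusion hK k • f y

/-- The stabilizer of a point of an `H`-set, as a subgroup of `G`. -/
def stab (H : Subgroup G) {S : Type u} [MulAction H S] (s : S) : Subgroup G :=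
  (MulAction.stabilizer H s).map H.subtype

lemma stab_le (H : Subgroup G) {S : Type u} [MulAction H S] (s : S) : stab H s ≤ H := by
  rintro _ ⟨h, _, rfl⟩
  exact h.2

lemma smul_eq_iff_mem_stab {H : Subgroup G} {S : Type u} [MulAction H S] (s : S) (h : H) :
    h • s = s ↔ (h : G) ∈ stab H s := by
  constructor
  · exact fun hh => ⟨h, hh, rfl⟩
  · rintro ⟨h', hh', h''⟩
    obtain rfl : h' = h := Subtype.ext h''
    exact hh'

/-- The action of the stabilizer of `s` on the fibre over `s` of a map of `H`-sets. -/
@[reducible] def fibreAction {H : Subgroup G} {T S : Type u} [MulAction H T] [MulAction H S]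
    {p : T → S} (hp : ∀ (h : H) (t : T), p (h • t) = h • p t) (s : S) :
    MulAction (stab H s) {t // p t = s} where
  smul k t := ⟨Subgroup.inclusion (stab_le H s) k • t.1, by
    rw [hp, t.2]
    exact (smul_eq_iff_mem_stab s _).mpr k.2⟩
  one_smul t := Subtype.ext (one_smul H t.1)
  mul_smul k l t := Subtype.ext
    (mul_smul (Subgroup.inclusion (stab_le H s) k) (Subgroup.inclusion (stab_le H s) l) t.1)

lemma isFibre_fibreAction {H : Subgroup G} {T S : Type u} [MulAction H T] [MulAction H S]
    {p : T → S} (hp : ∀ (h : H) (t : T), p (h • t) = h • p t) (s : S) :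
    letI := fibreAction hp s
    IsFibre p s (stab H s) (stab_le H s) {t // p t = s} Subtype.val :=
  letI := fibreAction hp s
  { smul_eq_iff := smul_eq_iff_mem_stab s
    injective := Subtype.val_injective
    range_eq := Subtype.range_val
    map_smul := fun _ _ => rfl }

/-- A coefficient system is closed under extensions if the source of a map of finite `H`-sets
belongs to it whenever the target `S` does, and the fibre over some point of every orbit of `S`
belongs to it as a set with an action of the stabilizer of the point. -/
def IsClosedUnderExtensions
    (mem : ∀ (H : Subgroup G) (T : Type u), MulAction H T → Prop) : Prop :=
  ∀ (H : Subgroup G) (T S : Type u) (a : MulAction H T) (b : MulAction H S) (p : T → S),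
    (∀ (h : H) (t : T), p (h • t) = h • p t) → mem H S b →
    (∀ s : S, ∃ (h : H) (K : Subgroup G) (hK : K ≤ H) (Y : Type u) (c : MulAction K Y)
      (f : Y → T), IsFibre p (h • s) K hK Y f ∧ mem K Y c) → mem H T a

namespace CoefficientSystem

variable (C : CoefficientSystem G)
  (hC : IsClosedUnderExtensions C.mem)

/-- A coefficient system closed under extensions is an indexing system: subobjects, coproducts and
induced sets map to the ambient set, to a trivial set and to an orbit, with admissible fibres. -/
def toIndexingSystem : IndexingSystem G where
  toCoefficientSystem := C
  sub_mem H S T a b f hf hfe hT := by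
    have := C.finite H T b hT
    refine hC H S T a b f hfe hT fun t => ?_
    refine ⟨1, stab H t, stab_le H t, {s // f s = t}, fibreAction hfe t, Subtype.val, ?_, ?_⟩
    · rw [one_smul]
      exact isFibre_fibreAction hfe t
    · have : Finite {s // f s = t} := Finite.of_injective _ (hf.comp Subtype.val_injective)
      exact C.trivial_mem _ _ _ this fun k s =>
        Subtype.ext (hf (Eq.trans (Subtype.prop (p := fun s => f s = t) _) s.2.symm))
  coprod_mem H ι T a _ hT := by
    let b : MulAction H ι :=
      { smul h i := i
        one_smul _ := rfl
        mul_smul _ _ _ := rfl }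
    refine hC H (Σ i, T i) ι inferInstance b Sigma.fst (fun _ _ => rfl)
      (C.trivial_mem H ι b inferInstance fun _ _ => rfl) fun i => ?_
    refine ⟨1, H, le_rfl, T i, a i, Sigma.mk i, ?_, hT i⟩
    exact
      { smul_eq_iff := fun h => ⟨fun _ => h.2, fun _ => rfl⟩
        injective := sigma_mk_injective
        range_eq := Set.range_sigmaMk i
        map_smul := fun _ _ => rfl }
  ind_mem K H hKH T a hT hHK := by
    let p : Induced hKH T → H ⧸ K.subgroupOf H :=
      Quotient.lift (fun q => (q.1 : H ⧸ K.subgroupOf H)) (by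
        rintro ⟨h, t⟩ ⟨h', t'⟩ ⟨k, rfl, _⟩
        refine (QuotientGroup.eq.mpr ?_).symm
        rw [Subgroup.mem_subgroupOf]
        simp)
    refine hC H (Induced hKH T) (H ⧸ K.subgroupOf H) inferInstance inferInstance p ?_ hHK ?_
    · intro h t
      induction t using Quotient.inductionOn with
      | h t => rfl
    · intro s
      obtain ⟨h, rfl⟩ := QuotientGroup.mk_surjective s
      refine ⟨h⁻¹, K, hKH, T, a, fun t => Quotient.mk (indSetoid hKH T) (1, t), ?_, hT⟩
      have h1 : h⁻¹ • (h : H ⧸ K.subgroupOf H) = ((1 : H) : H ⧸ K.subgroupOf H) := by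
        rw [MulAction.Quotient.smul_coe, smul_eq_mul, inv_mul_cancel]
      rw [h1]
      refine ⟨fun h' => ?_, fun t t' htt => ?_, ?_, fun k t => ?_⟩
      · rw [MulAction.Quotient.smul_coe, eq_comm, QuotientGroup.eq, Subgroup.mem_subgroupOf]
        simp
      · obtain ⟨k, hk, hk'⟩ := Quotient.exact htt
        have : k = 1 := by
          apply Subgroup.inclusion_injective hKH
          simpa using hk.symm
        simpa [this] using hk'.symm
      · ext x
        constructor
        · rintro ⟨t, rfl⟩
          rfl
        · intro hx
          induction x using Quotient.inductionOn with
          | h x =>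
            obtain ⟨h', t⟩ := x
            have : (h' : G) ∈ K := by
              have := QuotientGroup.eq.mp (show ((1 : H) : H ⧸ K.subgroupOf H) = h' from hx.symm)
              simpa [Subgroup.mem_subgroupOf] using this
            refine ⟨(⟨h', this⟩ : K) • t, Quotient.sound ⟨(⟨h', this⟩ : K)⁻¹, ?_, ?_⟩⟩
            · ext
              simp
            · simp
      · exact Quotient.sound ⟨k⁻¹, by simp, by simp⟩

end CoefficientSystem

/-- The sets of an indexing system are closed under extensions: the source of the map is a coproduct
of sets induced from the fibres over representatives of the orbits. -/
lemma IndexingSystem.isClosedUnderExtensions (F : IndexingSystem G) :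
    IsClosedUnderExtensions F.mem := by
  intro H T S a b p hp hS hfib
  have := F.finite H S b hS
  let Ω := MulAction.orbitRel.Quotient H S
  choose h K hK Y c f hf hY using fun ω : Ω => hfib ω.out
  let s : Ω → S := fun ω => h ω • ω.out
  replace hf (ω : Ω) : IsFibre p (s ω) (K ω) (hK ω) (Y ω) (f ω) := hf ω
  have hsω (ω : Ω) : (Quotient.mk (MulAction.orbitRel H S) (s ω)) = ω := by
    conv_rhs => rw [← Quotient.out_eq ω]
    exact Quotient.sound ⟨h ω, rfl⟩
  let φ : (Σ ω, Induced (hK ω) (Y ω)) → T := fun x =>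
    Quotient.lift (fun q : H × Y x.1 => q.1 • f x.1 q.2) (by
      rintro ⟨h, t⟩ ⟨h', t'⟩ ⟨k, h1, h2⟩
      simp only at h1 h2 ⊢
      rw [h1, h2, (hf _).map_smul, mul_smul]) x.2
  have hpf (ω : Ω) (y : Y ω) : p (f ω y) = s ω := by
    have : f ω y ∈ p ⁻¹' {s ω} := by rw [← (hf ω).range_eq]; exact ⟨y, rfl⟩
    exact this
  have hφ : Function.Bijective φ := by
    constructor
    · rintro ⟨ω, x⟩ ⟨ω', x'⟩ hxx
      induction x using Quotient.inductionOn with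
      | h x =>
      induction x' using Quotient.inductionOn with
      | h x' =>
      obtain ⟨g, y⟩ := x
      obtain ⟨g', y'⟩ := x'
      have hxx : g • f ω y = g' • f ω' y' := hxx
      have hpp := congrArg p hxx
      rw [hp, hp, hpf, hpf] at hpp
      obtain rfl : ω = ω' := by
        rw [← hsω ω, ← hsω ω']
        exact Quotient.sound ⟨g⁻¹ * g', by
          change (g⁻¹ * g') • s ω' = s ω
          rw [mul_smul, ← hpp, inv_smul_smul]⟩
      have hk : ((g'⁻¹ * g : H) : G) ∈ K ω := ((hf ω).smul_eq_iff _).mp (by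
        rw [mul_smul, hpp, inv_smul_smul])
      have hki : Subgroup.inclusion (hK ω) ⟨_, hk⟩ = g'⁻¹ * g := rfl
      refine congrArg (Sigma.mk ω) (Quotient.sound ⟨⟨_, hk⟩, ?_, ?_⟩)
      · rw [hki, mul_inv_cancel_left]
      · apply (hf ω).injective
        rw [(hf ω).map_smul, hki, mul_smul, hxx, inv_smul_smul]
    · intro t
      let ω : Ω := Quotient.mk (MulAction.orbitRel H S) (p t)
      obtain ⟨g, hg⟩ : ∃ g : H, g • s ω = p t := Quotient.exact (hsω ω).symm
      have : g⁻¹ • t ∈ Set.range (f ω) := by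
        rw [(hf ω).range_eq]
        change p _ = s ω
        rw [hp, ← hg, inv_smul_smul]
      obtain ⟨y, hy⟩ := this
      exact ⟨⟨ω, Quotient.mk _ (g, y)⟩, by
        change g • f ω y = t
        rw [hy, smul_inv_smul]⟩
  refine F.iso_mem H _ T inferInstance a (Equiv.ofBijective φ hφ) ?_
    (F.coprod_mem H Ω (fun ω => Induced (hK ω) (Y ω)) inferInstance inferInstance fun ω =>
      F.ind_mem (K ω) H (hK ω) (Y ω) (c ω) (hY ω) ?_)
  · rintro g ⟨ω, x⟩
    induction x using Quotient.inductionOn with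
    | h x => exact mul_smul g x.1 (f ω x.2)
  · let ψ : H ⧸ (K ω).subgroupOf H → S := Quotient.lift (fun g : H => g • s ω) (by
      intro g g' hg
      have := ((hf ω).smul_eq_iff (g⁻¹ * g')).mpr 
        (Subgroup.mem_subgroupOf.mp (QuotientGroup.leftRel_apply.mp hg))
      change g • s ω = g' • s ω
      conv_lhs => rw [← this]
      rw [← mul_smul, mul_inv_cancel_left])
    refine F.sub_mem H _ S inferInstance b ψ ?_ ?_ hS
    · intro x x' hxx
      induction x using Quotient.inductionOn with
      | h x =>
      induction x' using Quotient.inductionOn with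
      | h x' =>
      have hxx : x • s ω = x' • s ω := hxx
      refine QuotientGroup.eq.mpr (((hf ω).smul_eq_iff (x⁻¹ * x')).mp ?_)
      rw [mul_smul, ← hxx, inv_smul_smul]
    · intro g x
      induction x using Quotient.inductionOn with
      | h x => exact mul_smul g x (s ω)

end Fibrations

/-! ### Renumbering of inputs -/

section Relabel

variable {G : Type u} [Group G] {O : ℕ → Type u} [∀ n, MulAction (G × Equiv.Perm (Fin n)) (O n)]

lemma relabel_perm {n : ℕ} (e : Equiv.Perm (Fin n)) (x : O n) :
    relabel G O e x = ((1 : G), e) • x := rfl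

lemma relabel_trans {l m n : ℕ} (e : Fin l ≃ Fin m) (e' : Fin m ≃ Fin n) (x : O l) :
    relabel G O e' (relabel G O e x) = relabel G O (e.trans e') x := by
  obtain rfl : l = m := Fin.equiv_iff_eq.mp ⟨e⟩
  obtain rfl : l = n := Fin.equiv_iff_eq.mp ⟨e'⟩
  rw [relabel_perm, relabel_perm, relabel_perm, smul_smul, Prod.mk_mul_mk, one_mul]
  rfl

lemma mk_smul {n : ℕ} (g : G) (σ : Equiv.Perm (Fin n)) (x : O n) :
    (g, σ) • x = ((1 : G), σ) • (g, (1 : Equiv.Perm (Fin n))) • x := by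
  rw [smul_smul, Prod.mk_mul_mk, one_mul, mul_one]

end Relabel

section Composition

variable {G : Type u} [Group G] (O : GOperad G)

/-- The bijection of `j 1 + ⋯ + j k` with `j' 1 + ⋯ + j' k` letters which carries the letter `l` of
the block `i` to the letter `τ i l` of the block `σ i`. -/
def blockEquiv {k : ℕ} {j j' : Fin k → ℕ} (σ : Equiv.Perm (Fin k))
    (τ : ∀ i, Fin (j i) ≃ Fin (j' (σ i))) : Fin (∑ i, j i) ≃ Fin (∑ i, j' i) :=
  finSigmaFinEquiv.symm.trans ((Equiv.sigmaCongr σ τ).trans finSigmaFinEquiv)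

lemma blockEquiv_apply {k : ℕ} {j j' : Fin k → ℕ} (σ : Equiv.Perm (Fin k))
    (τ : ∀ i, Fin (j i) ≃ Fin (j' (σ i))) (i : Fin k) (l : Fin (j i)) :
    blockEquiv σ τ (finSigmaFinEquiv ⟨i, l⟩) = finSigmaFinEquiv ⟨σ i, τ i l⟩ := by
  simp [blockEquiv, Equiv.sigmaCongr]

lemma blockPerm_apply {k : ℕ} {j : Fin k → ℕ} (σ : Equiv.Perm (Fin k)) (i : Fin k)
    (l : Fin (j (σ i))) :
    blockPerm σ j (finSigmaFinEquiv ⟨i, l⟩) = finSigmaFinEquiv ⟨σ i, l⟩ := by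
  simp [blockPerm]

lemma GOperad.comp_relabel {k : ℕ} {j j' : Fin k → ℕ} (τ : ∀ i, Fin (j i) ≃ Fin (j' i))
    (x : O.obj k) (y : ∀ i, O.obj (j i)) :
    O.comp x (fun i => relabel G O.obj (τ i) (y i)) =
      relabel G O.obj (blockEquiv (Equiv.refl _) τ) (O.comp x y) := by
  obtain rfl : j = j' := funext fun i => Fin.equiv_iff_eq.mp ⟨τ i⟩
  refine (O.comp_perm τ x y).trans ?_
  rw [relabel_perm]
  rfl

/-- A composite of operations is fixed by `(g, π)` if `π` permutes the blocks of inputs in the way in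
which `(g, σ)` fixes the outer operation, and carries the blocks to each other compatibly with
the action of `g` on the inner operations. -/
lemma GOperad.smul_comp_eq_self {k : ℕ} {j : Fin k → ℕ} (g : G) (σ : Equiv.Perm (Fin k))
    (τ : ∀ i, Fin (j i) ≃ Fin (j (σ i))) (x : O.obj k) (y : ∀ i, O.obj (j i))
    (hx : (g, σ) • x = x)
    (hy : ∀ i, relabel G O.obj (τ i) ((g, (1 : Equiv.Perm (Fin (j i)))) • y i) = y (σ i)) :
    (g, blockEquiv σ τ) • O.comp x y = O.comp x y := by
  have h1 := O.perm_comp σ ((g, (1 : Equiv.Perm (Fin k))) • x) y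
  rw [← mk_smul, hx, ← funext hy, O.comp_relabel, relabel_trans, ← O.smul_comp] at h1
  rw [mk_smul, ← relabel_perm]
  conv_rhs => rw [h1]
  congr 1
  ext a
  obtain ⟨⟨i, l⟩, rfl⟩ := finSigmaFinEquiv.surjective a
  have h2 : blockEquiv (j' := fun i => j (σ i)) (Equiv.refl _) τ (finSigmaFinEquiv ⟨i, l⟩) =
      finSigmaFinEquiv (n := fun i => j (σ i)) ⟨i, τ i l⟩ :=
    @blockEquiv_apply k j (fun i => j (σ i)) (Equiv.refl _) τ i l
  rw [blockEquiv_apply]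
  exact congrArg Fin.val ((congrArg (blockPerm σ j) h2).trans (blockPerm_apply σ i (τ i l))).symm

end Composition

/-! ### The indexing system of an operad -/

section Admissible

variable {G : Type u} [Group G] (O : GOperad G)

lemma isAdmissible_iff {H : Subgroup G} {T : Type u} (a : MulAction H T) :
    IsAdmissible O H T a ↔ ∃ (n : ℕ) (e : T ≃ Fin n) (x : O.obj n),
      ∀ h : H, ((h : G), permRep e h) • x = x := by
  refine exists_congr fun n => exists_congr fun e => exists_congr fun x => ?_
  constructor
  · exact fun hx h => hx ⟨_, h, rfl⟩
  · rintro hx ⟨_, h, rfl⟩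
    exact hx h

lemma permRep_apply {H : Subgroup G} {T : Type u} [MulAction H T] {n : ℕ} (e : T ≃ Fin n)
    (h : H) (t : T) : permRep e h (e t) = e (h • t) := by
  simp [permRep, Equiv.permCongrHom]

lemma permRep_eq {H : Subgroup G} {T : Type u} [MulAction H T] {n : ℕ} (e : T ≃ Fin n)
    (h : H) (σ : Equiv.Perm (Fin n)) (hσ : ∀ t, σ (e t) = e (h • t)) : permRep e h = σ := by
  ext i
  obtain ⟨t, rfl⟩ := e.surjective i
  rw [permRep_apply, hσ]

/-- The admissible sets of an operad are closed under extensions: if the operation `x` witnesses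
that the base `S` is admissible, and the operations `y s` that the fibres are, chosen compatibly
along the orbits, then the composite of `x` and the `y s` witnesses that the total set is. -/
lemma isClosedUnderExtensions_isAdmissible : IsClosedUnderExtensions (IsAdmissible O) := by
  intro H T S a b p hp hS hfib
  obtain ⟨k, eS, x, hx⟩ := (isAdmissible_iff O b).mp hS
  let Ω := MulAction.orbitRel.Quotient H S
  choose r K hK Y c f hf hY using fun ω : Ω => hfib ω.out
  choose n e y hy using fun ω : Ω => (isAdmissible_iff O (c ω)).mp (hY ω)
  let s₀ : Ω → S := fun ω => r ω • ω.out
  replace hf (ω : Ω) : IsFibre p (s₀ ω) (K ω) (hK ω) (Y ω) (f ω) := hf ω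
  have hpf (ω : Ω) (y : Y ω) : p (f ω y) = s₀ ω := by
    have : f ω y ∈ p ⁻¹' {s₀ ω} := by rw [← (hf ω).range_eq]; exact ⟨y, rfl⟩
    exact this
  let orb : S → Ω := Quotient.mk (MulAction.orbitRel H S)
  have horb (h : H) (s : S) : orb (h • s) = orb s := Quotient.sound ⟨h, rfl⟩
  have hrep (s : S) : ∃ g : H, g • s₀ (orb s) = s := by
    have : orb (s₀ (orb s)) = orb s := (horb _ _).trans (Quotient.out_eq _)
    exact Quotient.exact this.symm
  choose g hg using hrep
  -- The identification of the fibres over `s` and `h • s` by the action of `h`.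
  have key (h : H) (ω ω' : Ω) (hω : ω = ω') (a a' : H) (ha : h • a • s₀ ω = a' • s₀ ω') :
      ∃ τ : Fin (n ω) ≃ Fin (n ω'),
        (∀ l, a' • f ω' ((e ω').symm (τ l)) = h • a • f ω ((e ω).symm l)) ∧
        relabel G O.obj τ (((h : G), (1 : Equiv.Perm (Fin (n ω)))) •
          ((a : G), (1 : Equiv.Perm (Fin (n ω)))) • y ω) =
          ((a' : G), (1 : Equiv.Perm (Fin (n ω')))) • y ω' := by
    subst hω
    have hk : ((a'⁻¹ * (h * a) : H) : G) ∈ K ω := ((hf ω).smul_eq_iff _).mp (by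
      rw [mul_smul, mul_smul, ha, inv_smul_smul])
    let κ : K ω := ⟨_, hk⟩
    refine ⟨permRep (e ω) κ, fun l => ?_, ?_⟩
    · obtain ⟨t, rfl⟩ := (e ω).surjective l
      rw [permRep_apply, Equiv.symm_apply_apply, Equiv.symm_apply_apply, (hf ω).map_smul]
      have : Subgroup.inclusion (hK ω) κ = a'⁻¹ * (h * a) := rfl
      rw [this, mul_smul, mul_smul, smul_inv_smul]
    · have h1 := hy ω κ
      rw [relabel_perm, smul_smul, smul_smul]
      conv_rhs => rw [← h1, smul_smul]
      congr 1
      ext <;> simp [κ]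
  let j : Fin k → ℕ := fun i => n (orb (eS.symm i))
  let z : ∀ i, O.obj (j i) := fun i =>
    ((g (eS.symm i) : G), (1 : Equiv.Perm (Fin (j i)))) • y (orb (eS.symm i))
  let Ψ : (Σ i, Fin (j i)) → T := fun q =>
    g (eS.symm q.1) • f (orb (eS.symm q.1)) ((e _).symm q.2)
  have hpΨ (q) : p (Ψ q) = eS.symm q.1 := by
    rw [hp, hpf, hg]
  have hΨ : Function.Bijective Ψ := by
    constructor
    · rintro ⟨i, l⟩ ⟨i', l'⟩ h
      have hi := congrArg p h
      rw [hpΨ, hpΨ] at hi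
      obtain rfl : i = i' := eS.symm.injective hi
      have := (e _).symm.injective ((hf _).injective (MulAction.injective _ h))
      exact congrArg (Sigma.mk i) this
    · intro t
      have : (g (p t))⁻¹ • t ∈ Set.range (f (orb (p t))) := by
        rw [(hf _).range_eq]
        change p _ = s₀ _
        rw [hp, inv_smul_eq_iff, hg]
      obtain ⟨w, hw⟩ := this
      have hsec (s : S) (hs : s = p t) : ∃ l, g s • f (orb s) ((e (orb s)).symm l) = t := by
        subst hs
        exact ⟨e _ w, by rw [Equiv.symm_apply_apply, hw, smul_inv_smul]⟩
      obtain ⟨l, hl⟩ := hsec (eS.symm (eS (p t))) (eS.symm_apply_apply _)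
      exact ⟨⟨eS (p t), l⟩, hl⟩
  let eT : T ≃ Fin (∑ i, j i) := (Equiv.ofBijective Ψ hΨ).symm.trans finSigmaFinEquiv
  have heT (q) : eT (Ψ q) = finSigmaFinEquiv q :=
    congrArg finSigmaFinEquiv ((Equiv.ofBijective Ψ hΨ).symm_apply_apply q)
  refine (isAdmissible_iff O a).mpr ⟨∑ i, j i, eT, O.comp x z, fun h => ?_⟩
  have hσ (i : Fin k) : eS.symm (permRep eS h i) = h • eS.symm i := by
    obtain ⟨s, rfl⟩ := eS.surjective i
    rw [permRep_apply, Equiv.symm_apply_apply, Equiv.symm_apply_apply]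
  choose τ hτ hτ' using fun i : Fin k => key h (orb (eS.symm i)) (orb (eS.symm (permRep eS h i)))
    (by rw [hσ, horb]) (g (eS.symm i)) (g (eS.symm (permRep eS h i))) (by rw [hg, hg, hσ])
  rw [permRep_eq eT h (blockEquiv (j := j) (j' := j) (permRep eS h) τ)]
  · exact O.smul_comp_eq_self (h : G) (permRep eS h) τ x z (hx h) hτ'
  · intro t
    obtain ⟨⟨i, l⟩, rfl⟩ := hΨ.2 t
    rw [heT, blockEquiv_apply, ← heT]
    exact congrArg eT (hτ i l)

/-- The coefficient system of the admissible sets of an `N_∞` operad. -/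
def admissibleSets (hO : IsNInfinity G O) : CoefficientSystem G where
  mem := IsAdmissible O
  finite H T a h := by
    obtain ⟨n, e, _⟩ := h
    exact Finite.of_equiv _ e.symm
  trivial_mem H T a hT h := by
    obtain ⟨n, ⟨e⟩⟩ := Finite.exists_equiv_fin T
    obtain ⟨x, hx⟩ := hO.nonempty n H
    refine (isAdmissible_iff O a).mpr ⟨n, e, x, fun g => ?_⟩
    rw [permRep_eq e g 1 fun t => by rw [h]; rfl]
    exact hx ⟨((g : G), 1), g.2, rfl⟩
  iso_mem H S T a b e he hS := by
    obtain ⟨n, e', x, hx⟩ := (isAdmissible_iff O a).mp hS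
    refine (isAdmissible_iff O b).mpr ⟨n, e.symm.trans e', x, fun h => ?_⟩
    rw [permRep_eq _ h (permRep e' h) fun t => ?_]
    · exact hx h
    · obtain ⟨s, rfl⟩ := e.surjective t
      simp [← he, permRep_apply]
  res_mem K H hKH T a hT := by
    obtain ⟨n, e, x, hx⟩ := (isAdmissible_iff O a).mp hT
    exact (isAdmissible_iff O _).mpr ⟨n, e, x, fun h => hx (Subgroup.inclusion hKH h)⟩
  conj_mem H T a g hT := by
    obtain ⟨n, e, x, hx⟩ := (isAdmissible_iff O a).mp hT
    refine (isAdmissible_iff O _).mpr ⟨n, e, (g, (1 : Equiv.Perm (Fin n))) • x, fun h => ?_⟩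
    let φ := H.equivMapOfInjective (MulAut.conj g).toMonoidHom (MulAut.conj g).injective
    obtain ⟨h, rfl⟩ := φ.surjective h
    have h1 : ((φ h : H.map (MulAut.conj g).toMonoidHom) : G) = g * h * g⁻¹ := rfl
    have h2 : @permRep _ _ _ _ (conjAction g a) n e (φ h) = permRep e h := by
      refine @permRep_eq _ _ _ _ (conjAction g a) n e _ _ fun t => ?_
      rw [permRep_apply]
      congr 1
      change h • t = φ.symm (φ h) • t
      rw [MulEquiv.symm_apply_apply]
    rw [h1, h2]
    conv_rhs => rw [← hx h]
    rw [smul_smul, smul_smul]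
    congr 1
    ext <;> simp

/-- The indexing system of the admissible sets of an `N_∞` operad. -/
def admissibleIndexingSystem (hO : IsNInfinity G O) : IndexingSystem G :=
  (admissibleSets O hO).toIndexingSystem (isClosedUnderExtensions_isAdmissible O)

lemma IsAdmissible.map {O P : GOperad G} (f : O ⟶ P) {H : Subgroup G} {T : Type u}
    {a : MulAction H T} (h : IsAdmissible O H T a) : IsAdmissible P H T a := by
  obtain ⟨n, e, x, hx⟩ := (isAdmissible_iff O a).mp h
  refine (isAdmissible_iff P a).mpr ⟨n, e, GOperad.Hom.app f n x, fun h => ?_⟩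
  rw [← GOperad.Hom.map_smul f, hx]

variable (G) in
/-- The functor that sends an `N_∞` operad to the indexing system of its admissible sets. -/
def admissibleFunctor : NInfOperad G ⥤ IndexingSystem G where
  obj O := admissibleIndexingSystem O.obj O.property
  map f := homOfLE fun _ _ _ h => IsAdmissible.map f.hom h

end Admissible

/-! ### Products of operads -/

section Products

variable {G : Type u} [Group G]

lemma KProd.continuous_mk_of_compact {K X Y : Type u} [TopologicalSpace X] [TopologicalSpace Y]
    [TopologicalSpace K] [CompactSpace K] [T2Space K] {f : K → X} {g : K → Y} (hf : Continuous f)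
    (hg : Continuous g) : Continuous fun k => KProd.mk (f k) (g k) :=
  continuous_compactlyGenerated_of_compact (X := X × Y) (hf.prodMk hg)

instance {M X Y : Type u} [Monoid M] [MulAction M X] [MulAction M Y] : MulAction M (KProd X Y) :=
  inferInstanceAs (MulAction M (X × Y))

lemma KProd.relabel_eq {A B : ℕ → Type u} [∀ n, MulAction (G × Equiv.Perm (Fin n)) (A n)]
    [∀ n, MulAction (G × Equiv.Perm (Fin n)) (B n)] {m n : ℕ} (e : Fin m ≃ Fin n)
    (x : KProd (A m) (B m)) :
    relabel G (fun n => KProd (A n) (B n)) e x =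
      KProd.mk (relabel G A e x.1) (relabel G B e x.2) := by
  obtain rfl : m = n := Fin.equiv_iff_eq.mp ⟨e⟩
  rfl

lemma KProd.sigma_eq {A B : ℕ → Type u} {m n : ℕ} {a : A m} {a' : A n} {b : B m} {b' : B n}
    (h : (⟨m, a⟩ : Σ n, A n) = ⟨n, a'⟩) (h' : (⟨m, b⟩ : Σ n, B n) = ⟨n, b'⟩) :
    (⟨m, KProd.mk a b⟩ : Σ n, KProd (A n) (B n)) = ⟨n, KProd.mk a' b'⟩ := by
  cases h
  cases h'
  rfl

lemma GOperad.continuous_comp_of_compact (O : GOperad G) {K : Type u} [TopologicalSpace K]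
    [CompactSpace K] [T2Space K] {k : ℕ} {j : Fin k → ℕ} {x : K → O.obj k}
    {y : K → ∀ i, O.obj (j i)} (hx : Continuous x) (hy : Continuous y) :
    Continuous fun s => O.comp (x s) (y s) :=
  @Continuous.comp K (O.obj k × ∀ i, O.obj (j i)) _ _
    (TopologicalSpace.compactlyGenerated.{u} (O.obj k × ∀ i, O.obj (j i))) _
    (fun s => (x s, y s)) _ O.continuous_comp
    (continuous_compactlyGenerated_of_compact (hx.prodMk hy))

/-- The product of two operads in `G`-spaces. -/
def GOperad.prod (O P : GOperad G) : GOperad G where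
  obj n := KProd (O.obj n) (P.obj n)
  continuous_act n := ⟨fun g => KProd.continuous_mk
    ((continuous_const_smul g).comp KProd.continuous_fst)
    ((continuous_const_smul g).comp KProd.continuous_snd)⟩
  one := KProd.mk O.one P.one
  comp x y := KProd.mk (O.comp x.1 fun i => (y i).1) (P.comp x.2 fun i => (y i).2)
  continuous_comp {k j} := by
    refine continuous_from_compactlyGenerated _ fun S g => ?_
    have h1 : Continuous fun s => (g s).1 := continuous_fst.comp g.continuous
    have h2 (i : Fin k) : Continuous fun s => (g s).2 i :=
      (continuous_apply i).comp (continuous_snd.comp g.continuous)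
    exact KProd.continuous_mk_of_compact
      (O.continuous_comp_of_compact (KProd.continuous_fst.comp h1)
        (continuous_pi fun i => KProd.continuous_fst.comp (h2 i)))
      (P.continuous_comp_of_compact (KProd.continuous_snd.comp h1)
        (continuous_pi fun i => KProd.continuous_snd.comp (h2 i)))
  one_comp y := KProd.sigma_eq (O.one_comp _) (P.one_comp _)
  comp_one x := KProd.sigma_eq (O.comp_one x.1) (P.comp_one x.2)
  assoc x y z := KProd.sigma_eq (O.assoc x.1 _ fun i l => (z i l).1)
    (P.assoc x.2 _ fun i l => (z i l).2)
  perm_comp σ x y := by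
    rw [KProd.relabel_eq]
    exact congrArg₂ KProd.mk (O.perm_comp σ x.1 _) (P.perm_comp σ x.2 _)
  comp_perm τ x y := congrArg₂ KProd.mk (O.comp_perm τ x.1 _) (P.comp_perm τ x.2 _)
  smul_one g := congrArg₂ KProd.mk (O.smul_one g) (P.smul_one g)
  smul_comp g x y := congrArg₂ KProd.mk (O.smul_comp g x.1 _) (P.smul_comp g x.2 _)

/-- The first projection. -/
def GOperad.fst (O P : GOperad G) : O.prod P ⟶ O :=
  ({ app := fun _ x => x.1
     continuous_app := fun _ => KProd.continuous_fst
     map_smul := fun _ _ _ => rfl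
     map_one := rfl
     map_comp := fun _ _ => rfl } : GOperad.Hom (O.prod P) O)

/-- The second projection. -/
def GOperad.snd (O P : GOperad G) : O.prod P ⟶ P :=
  ({ app := fun _ x => x.2
     continuous_app := fun _ => KProd.continuous_snd
     map_smul := fun _ _ _ => rfl
     map_one := rfl
     map_comp := fun _ _ => rfl } : GOperad.Hom (O.prod P) P)

/-- The map to a product with given components. -/
def GOperad.lift {Q O P : GOperad G} (f : Q ⟶ O) (g : Q ⟶ P) : Q ⟶ O.prod P :=
  ({ app := fun n x => KProd.mk (GOperad.Hom.app f n x) (GOperad.Hom.app g n x)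
     continuous_app := fun n =>
      KProd.continuous_mk (GOperad.Hom.continuous_app f n) (GOperad.Hom.continuous_app g n)
     map_smul := fun n a x =>
      congrArg₂ KProd.mk (GOperad.Hom.map_smul f n a x) (GOperad.Hom.map_smul g n a x)
     map_one := congrArg₂ KProd.mk (GOperad.Hom.map_one f) (GOperad.Hom.map_one g)
     map_comp := fun x y =>
      congrArg₂ KProd.mk (GOperad.Hom.map_comp f x y) (GOperad.Hom.map_comp g x y) } :
    GOperad.Hom Q (O.prod P))

lemma isClosed_fixedPoints {X M : Type u} [TopologicalSpace X] [CompactlyGeneratedSpace X]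
    [WeaklyHausdorffSpace X] [Group M] [MulAction M X] [ContinuousConstSMul M X]
    (Λ : Subgroup M) : IsClosed (MulAction.fixedPoints Λ X) := by
  have : MulAction.fixedPoints Λ X = ⋂ l : Λ, {x | (l : M) • x = x} := by
    ext x
    simp only [MulAction.mem_fixedPoints, Set.mem_iInter]
    rfl
  rw [this]
  exact isClosed_iInter fun l => isClosed_eqLocus (continuous_const_smul (l : M)) continuous_id

lemma mem_fixedPoints_prod {O P : GOperad G} {n : ℕ} {Λ : Subgroup (G × Equiv.Perm (Fin n))}
    (p : (O.prod P).obj n) : p ∈ MulAction.fixedPoints Λ ((O.prod P).obj n) ↔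
      p.1 ∈ MulAction.fixedPoints Λ (O.obj n) ∧ p.2 ∈ MulAction.fixedPoints Λ (P.obj n) := by
  constructor
  · exact fun h => ⟨fun l => congrArg Prod.fst (h l), fun l => congrArg Prod.snd (h l)⟩
  · exact fun h l => Prod.ext (h.1 l) (h.2 l)

lemma IsNInfinity.contractibleSpace {O : GOperad G} (hO : IsNInfinity G O) {n : ℕ}
    {Λ : Subgroup (G × Equiv.Perm (Fin n))} (h : (MulAction.fixedPoints Λ (O.obj n)).Nonempty) :
    ContractibleSpace (MulAction.fixedPoints Λ (O.obj n)) :=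
  (hO.empty_or_contractible n Λ).resolve_left fun h' => h'.false h.to_subtype.some

lemma IsNInfinity.prod {O P : GOperad G} (hO : IsNInfinity G O) (hP : IsNInfinity G P) :
    IsNInfinity G (O.prod P) where
  free n σ x h := hO.free n σ x.1 (congrArg Prod.fst h)
  empty_or_contractible n Λ := by
    refine or_iff_not_imp_left.mpr fun h => ?_
    obtain ⟨⟨p, hp⟩⟩ := not_isEmpty_iff.mp h
    have hp := (mem_fixedPoints_prod p).mp hp
    have := hO.contractibleSpace ⟨_, hp.1⟩
    have := hP.contractibleSpace ⟨_, hp.2⟩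
    exact KProd.contractibleSpace (isClosed_fixedPoints (X := (O.prod P).obj n) Λ)
      mem_fixedPoints_prod
  nonempty n H := by
    obtain ⟨x, hx⟩ := hO.nonempty n H
    obtain ⟨y, hy⟩ := hP.nonempty n H
    exact ⟨KProd.mk x y, (mem_fixedPoints_prod _).mpr ⟨hx, hy⟩⟩

/-- Admissibility does not depend on the ordering of the set. -/
lemma IsAdmissible.exists_smul_eq {O : GOperad G} {H : Subgroup G} {T : Type u} {a : MulAction H T}
    (h : IsAdmissible O H T a) {n : ℕ} (e : T ≃ Fin n) :
    ∃ x : O.obj n, ∀ h : H, ((h : G), permRep e h) • x = x := by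
  obtain ⟨m, e', x, hx⟩ := (isAdmissible_iff O a).mp h
  obtain rfl : m = n := Fin.equiv_iff_eq.mp ⟨e'.symm.trans e⟩
  let π : Equiv.Perm (Fin m) := e'.symm.trans e
  refine ⟨((1 : G), π) • x, fun h => ?_⟩
  have hπ : permRep e h * π = π * permRep e' h := by
    ext i
    obtain ⟨t, rfl⟩ := e'.surjective i
    simp [π, permRep_apply]
  conv_rhs => rw [← hx h]
  rw [smul_smul, smul_smul, Prod.mk_mul_mk, Prod.mk_mul_mk, hπ, one_mul, mul_one]

/-- If all admissible sets of the `N_∞` operad `O` are admissible for `P`, then a subgroup with fixed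
points in `O` has fixed points in `P`: by freeness, it is the graph of a permutation
representation. -/
lemma IsNInfinity.fixedPoints_nonempty {O P : GOperad G} (hO : IsNInfinity G O)
    (h : ∀ (H : Subgroup G) (T : Type u) (a : MulAction H T),
      IsAdmissible O H T a → IsAdmissible P H T a)
    {n : ℕ} {Λ : Subgroup (G × Equiv.Perm (Fin n))}
    (hΛ : (MulAction.fixedPoints Λ (O.obj n)).Nonempty) :
    (MulAction.fixedPoints Λ (P.obj n)).Nonempty := by
  obtain ⟨x, hx⟩ := hΛ
  let f : Λ →* G := (MonoidHom.fst G _).comp Λ.subtype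
  have hf : Function.Injective f := by
    refine (injective_iff_map_eq_one f).mpr ?_
    rintro ⟨⟨g, σ⟩, hl⟩ (rfl : g = 1)
    obtain rfl := hO.free n σ x (hx ⟨_, hl⟩)
    rfl
  let H : Subgroup G := f.range
  let φ : Λ ≃* H := MonoidHom.ofInjective hf
  let α : H →* Equiv.Perm (Fin n) := ((MonoidHom.snd G _).comp Λ.subtype).comp φ.symm.toMonoidHom
  let a : MulAction H (ULift.{u} (Fin n)) := MulAction.compHom _ α
  have hα (l : Λ) : ((φ l : G), permRep (Equiv.ulift (α := Fin n)) (φ l)) = (l : G × _) := by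
    refine Prod.ext rfl ?_
    refine permRep_eq _ _ _ fun t => ?_
    change _ = (φ.symm (φ l) : G × Equiv.Perm (Fin n)).2 t.down
    rw [MulEquiv.symm_apply_apply]
    rfl
  obtain ⟨y, hy⟩ := (h H _ a ((isAdmissible_iff O a).mpr ⟨n, Equiv.ulift, x, fun h => by
    obtain ⟨l, rfl⟩ := φ.surjective h
    rw [hα]
    exact hx l⟩)).exists_smul_eq Equiv.ulift
  refine ⟨y, fun l => ?_⟩
  have := hy (φ l)
  rwa [hα] at this

variable (G) in
/-- Products of `N_∞` operads. -/
def nInfinityProducts : WeakProducts (NInfOperad G) where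
  prod O P := ⟨O.obj.prod P.obj, O.property.prod P.property⟩
  fst O P := ObjectProperty.homMk (GOperad.fst O.obj P.obj)
  snd O P := ObjectProperty.homMk (GOperad.snd O.obj P.obj)
  lift f g := ObjectProperty.homMk (GOperad.lift f.hom g.hom)
  lift_fst _ _ := rfl
  lift_snd _ _ := rfl

lemma weakEquivalences_fst (O P : NInfOperad G)
    (h : (admissibleFunctor G).obj O ≤ (admissibleFunctor G).obj P) :
    weakEquivalences G ((nInfinityProducts G).fst O P) := by
  intro n Λ
  obtain hO | hO := (MulAction.fixedPoints Λ (O.obj.obj n)).eq_empty_or_nonempty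
  · have : IsEmpty (MulAction.fixedPoints Λ (O.obj.obj n)) := Set.isEmpty_coe_sort.mpr hO
    exact isWeakHomotopyEquiv_of_isEmpty (Y := MulAction.fixedPoints Λ (O.obj.obj n)) _
  · obtain ⟨y, hy⟩ := O.property.fixedPoints_nonempty h hO
    have := O.property.contractibleSpace hO
    obtain ⟨x, hx⟩ := hO
    have := (O.property.prod P.property).contractibleSpace
      ⟨KProd.mk x y, (mem_fixedPoints_prod _).mpr ⟨hx, hy⟩⟩
    exact isWeakHomotopyEquiv_of_contractible
      (X := MulAction.fixedPoints Λ ((O.obj.prod P.obj).obj n))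
      (Y := MulAction.fixedPoints Λ (O.obj.obj n)) _

lemma isInvertedBy_admissibleFunctor :
    (weakEquivalences G).IsInvertedBy (admissibleFunctor G) := by
  intro O P f hf
  have h : (admissibleFunctor G).obj P ≤ (admissibleFunctor G).obj O := by
    intro H T a hT
    obtain ⟨n, e, x⟩ := hT
    have := (hf n (graphSubgroup (permRep (H := H) e))).nonempty x.to_subtype
    exact ⟨n, e, Set.nonempty_coe_sort.mp this⟩
  exact ⟨homOfLE h, Subsingleton.elim _ _, Subsingleton.elim _ _⟩

end Products

/-! ### Step functions with values in an operad -/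

section StepFunctions

open MeasureTheory

/-- Functions from `[0, 1)` to `X` which are locally constant from the right. They are topologized
by convergence in measure, and form a contractible space unless `X` is empty. -/
structure StepFun (X : Type u) : Type u where
  toFun : Set.Ico (0 : ℝ) 1 → X
  eventually_eq : ∀ t : Set.Ico (0 : ℝ) 1, ∀ᶠ s in 𝓝[≥] (t : ℝ),
    ∀ hs : s ∈ Set.Ico (0 : ℝ) 1, toFun ⟨s, hs⟩ = toFun t

namespace StepFun

variable {X Y : Type u}

instance : CoeFun (StepFun X) (fun _ => Set.Ico (0 : ℝ) 1 → X) := ⟨StepFun.toFun⟩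

@[ext] lemma ext {f g : StepFun X} (h : ∀ t, f t = g t) : f = g := by
  cases f
  cases g
  congr
  exact funext h

/-- The constant functions. -/
def const (x : X) : StepFun X := ⟨fun _ => x, fun _ => Filter.Eventually.of_forall fun _ _ => rfl⟩

/-- Composition with a map. -/
def map (φ : X → Y) (f : StepFun X) : StepFun Y :=
  ⟨fun t => φ (f t), fun t => (f.2 t).mono fun _ h hs => congrArg φ (h hs)⟩

/-- The set of points at which two functions differ. -/
def diff (f g : StepFun X) : Set ℝ := Subtype.val '' {t | f t ≠ g t}

lemma measure_ne_top {s : Set ℝ} (hs : s ⊆ Set.Icc 0 1) : volume s ≠ ⊤ :=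
  measure_ne_top_of_subset hs (by simp)

lemma diff_subset (f g : StepFun X) : diff f g ⊆ Set.Icc 0 1 := by
  rintro _ ⟨t, _, rfl⟩
  exact ⟨t.2.1, t.2.2.le⟩

lemma diff_self (f : StepFun X) : diff f f = ∅ := by
  simp [diff]

lemma diff_comm (f g : StepFun X) : diff f g = diff g f := by
  simp [diff, ne_comm]

lemma diff_triangle (f g h : StepFun X) : diff f h ⊆ diff f g ∪ diff g h := by
  rintro _ ⟨t, ht, rfl⟩
  by_cases h1 : f t = g t
  · exact Or.inr ⟨t, fun h2 => ht (h1.trans h2), rfl⟩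
  · exact Or.inl ⟨t, h1, rfl⟩

lemma eq_of_measure_diff_eq_zero {f g : StepFun X} (h : volume.real (diff f g) = 0) : f = g := by
  by_contra hne
  obtain ⟨t, ht⟩ : ∃ t, f t ≠ g t := by
    by_contra h'
    push Not at h'
    exact hne (ext h')
  obtain ⟨u, hu, hsub⟩ := mem_nhdsGE_iff_exists_Ico_subset.mp
    (Filter.inter_mem (f.2 t) (g.2 t))
  have htu : (t : ℝ) < min u 1 := lt_min hu t.2.2
  have hI : Set.Ico (t : ℝ) (min u 1) ⊆ diff f g := by
    intro s hs
    have hs' : s ∈ Set.Ico (0 : ℝ) 1 := ⟨t.2.1.trans hs.1, hs.2.trans_le (min_le_right _ _)⟩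
    obtain ⟨h1, h2⟩ := hsub ⟨hs.1, hs.2.trans_le (min_le_left _ _)⟩
    exact ⟨⟨s, hs'⟩, fun hh => ht ((h1 hs').symm.trans (hh.trans (h2 hs'))), rfl⟩
  have := measureReal_mono hI (measure_ne_top (diff_subset f g))
  rw [h, Real.volume_real_Ico_of_le htu.le] at this
  linarith

/-- The distance of two functions is the measure of the set on which they differ. -/
noncomputable instance : MetricSpace (StepFun X) where
  dist f g := volume.real (diff f g)
  dist_self f := by simp [diff_self]
  dist_comm f g := by rw [diff_comm]
  dist_triangle f g h :=
    (measureReal_mono (diff_triangle f g h) (measure_ne_top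
      (Set.union_subset (diff_subset f g) (diff_subset g h)))).trans (measureReal_union_le _ _)
  eq_of_dist_eq_zero := eq_of_measure_diff_eq_zero

lemma dist_eq (f g : StepFun X) : dist f g = volume.real (diff f g) := rfl

lemma dist_map_le (φ : X → Y) (f g : StepFun X) : dist (map φ f) (map φ g) ≤ dist f g := by
  refine measureReal_mono ?_ (measure_ne_top (diff_subset f g))
  rintro _ ⟨t, ht, rfl⟩
  exact ⟨t, fun h => ht (congrArg φ h), rfl⟩

/-- The function which is `x` on `[0, t)` and `f` on `[t, 1)`. -/
noncomputable def cut (x : X) (t : ℝ) (f : StepFun X) : StepFun X := by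
  refine ⟨fun s => open Classical in if (s : ℝ) < t then x else f s, fun s => ?_⟩
  by_cases h : (s : ℝ) < t
  · filter_upwards [nhdsWithin_le_nhds (Iio_mem_nhds h)] with r hr _
    rw [if_pos h, if_pos (Set.mem_Iio.mp hr)]
  · filter_upwards [f.2 s, self_mem_nhdsWithin] with r hr hr' hs
    rw [if_neg h, if_neg (not_lt.mpr ((not_lt.mp h).trans hr')), hr]

lemma cut_of_lt (x : X) (f : StepFun X) {t : ℝ} {s : Set.Ico (0 : ℝ) 1} (h : s < t) :
    cut x t f s = x := if_pos h

lemma cut_of_le (x : X) (f : StepFun X) {t : ℝ} {s : Set.Ico (0 : ℝ) 1} (h : t ≤ s) :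
    cut x t f s = f s := if_neg (not_lt.mpr h)

lemma dist_cut_le (x : X) (t t' : unitInterval) (f f' : StepFun X) :
    dist (cut x t f) (cut x t' f') ≤ dist t t' + dist f f' := by
  have hsub : diff (cut x t f) (cut x t' f') ⊆ Set.uIcc (t : ℝ) t' ∪ diff f f' := by
    rintro _ ⟨s, hs, rfl⟩
    by_contra hn
    rw [Set.mem_union, not_or, Set.mem_uIcc] at hn
    obtain ⟨h1, h2⟩ := hn
    have h2 : f s = f' s := by_contra fun h => h2 ⟨s, h, rfl⟩
    apply hs
    rcases lt_or_ge (s : ℝ) t with h | h <;> rcases lt_or_ge (s : ℝ) t' with h' | h'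
    · rw [cut_of_lt x f h, cut_of_lt x f' h']
    · exact absurd (Or.inr ⟨h', h.le⟩) h1
    · exact absurd (Or.inl ⟨h, h'.le⟩) h1
    · rw [cut_of_le x f h, cut_of_le x f' h', h2]
  have hI : Set.uIcc (t : ℝ) t' ⊆ Set.Icc 0 1 := Set.uIcc_subset_Icc t.2 t'.2
  refine (measureReal_mono hsub (measure_ne_top (Set.union_subset hI (diff_subset _ _)))).trans
    ((measureReal_union_le _ _).trans (add_le_add_left (le_of_eq ?_) _))
  rw [Set.uIcc, Real.volume_real_Icc_of_le inf_le_sup, Subtype.dist_eq, Real.dist_eq,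
    max_sub_min_eq_abs, abs_sub_comm]

/-- A set of functions closed under cutting with the value `x` is contractible. -/
lemma contractibleSpace {c : Set (StepFun X)} (x : X) (hx : const x ∈ c)
    (h : ∀ (t : unitInterval), ∀ f ∈ c, cut x t f ∈ c) : ContractibleSpace c := by
  rw [contractible_iff_id_nullhomotopic]
  let Φ : unitInterval × c → c := fun p => ⟨cut x p.1 p.2.1, h p.1 _ p.2.2⟩
  have hΦ : LipschitzWith 2 Φ := by
    refine LipschitzWith.of_dist_le_mul fun p q => ?_
    refine (dist_cut_le x p.1 q.1 p.2.1 q.2.1).trans ?_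
    have h1 : dist p.1 q.1 ≤ dist p q := le_max_left _ _
    have h2 : dist p.2.1 q.2.1 ≤ dist p q := le_max_right _ _
    change _ ≤ 2 * dist p q
    linarith
  refine ⟨⟨const x, hx⟩, ⟨⟨⟨Φ, hΦ.continuous⟩, fun f => ?_, fun f => ?_⟩⟩⟩
  · exact Subtype.ext (ext fun s => cut_of_le x f.1 s.2.1)
  · exact Subtype.ext (ext fun s => cut_of_lt x f.1 s.2.2)

instance {M : Type*} [Monoid M] [MulAction M X] : MulAction M (StepFun X) where
  smul m := map (m • ·)
  one_smul f := ext fun t => one_smul M (f t)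
  mul_smul m m' f := ext fun t => mul_smul m m' (f t)

instance {M : Type*} [Monoid M] [MulAction M X] : ContinuousConstSMul M (StepFun X) where
  continuous_const_smul m := by
    have : LipschitzWith 1 (fun f : StepFun X => m • f) :=
      LipschitzWith.of_dist_le_mul fun f g => by
        rw [NNReal.coe_one, one_mul]
        exact dist_map_le (m • ·) f g
    exact this.continuous

lemma sigma_eq {A : ℕ → Type u} {m n : ℕ} {f : StepFun (A m)} {g : StepFun (A n)}
    (h : ∀ t, (⟨m, f t⟩ : Σ n, A n) = ⟨n, g t⟩) :
    (⟨m, f⟩ : Σ n, StepFun (A n)) = ⟨n, g⟩ := by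
  obtain rfl : m = n := congrArg Sigma.fst (h ⟨0, by simp⟩)
  exact congrArg (Sigma.mk m) (ext fun t => eq_of_heq (Sigma.mk.inj (h t)).2)

lemma relabel_apply {G : Type u} [Group G] {A : ℕ → Type u}
    [∀ n, MulAction (G × Equiv.Perm (Fin n)) (A n)] {m n : ℕ} (e : Fin m ≃ Fin n)
    (f : StepFun (A m)) (t : Set.Ico (0 : ℝ) 1) :
    relabel G (fun n => StepFun (A n)) e f t = relabel G A e (f t) := by
  obtain rfl : m = n := Fin.equiv_iff_eq.mp ⟨e⟩
  rfl

end StepFun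

variable {G : Type u} [Group G]

instance {X : Type u} [TopologicalSpace X] [T2Space X] : WeaklyHausdorffSpace X :=
  ⟨fun _ _ _ _ _ hf => (isCompact_range hf).isClosed⟩

/-- The pointwise composition of step functions with values in an operad. -/
def StepFun.comp (O : GOperad G) {k : ℕ} {j : Fin k → ℕ} (x : StepFun (O.obj k))
    (y : ∀ i, StepFun (O.obj (j i))) : StepFun (O.obj (∑ i, j i)) :=
  ⟨fun t => O.comp (x t) fun i => y i t, fun t => by
    filter_upwards [x.2 t, Filter.eventually_all.mpr fun i => (y i).2 t] with s h1 h2 hs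
    rw [h1 hs]
    exact congrArg (O.comp (x t)) (funext fun i => h2 i hs)⟩

lemma StepFun.dist_comp_le (O : GOperad G) {k : ℕ} {j : Fin k → ℕ} (x x' : StepFun (O.obj k))
    (y y' : ∀ i, StepFun (O.obj (j i))) :
    dist (StepFun.comp O x y) (StepFun.comp O x' y') ≤
      dist x x' + ∑ i, dist (y i) (y' i) := by
  have hsub : diff (StepFun.comp O x y) (StepFun.comp O x' y') ⊆
      diff x x' ∪ ⋃ i, diff (y i) (y' i) := by
    rintro _ ⟨t, ht, rfl⟩
    by_contra hn
    rw [Set.mem_union, not_or, Set.mem_iUnion, not_exists] at hn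
    obtain ⟨h1, h2⟩ := hn
    have h1 : x t = x' t := by_contra fun h => h1 ⟨t, h, rfl⟩
    have h2 : (fun i => y i t) = fun i => y' i t :=
      funext fun i => by_contra fun h => h2 i ⟨t, h, rfl⟩
    exact ht (congrArg₂ O.comp h1 h2)
  have hfin := measure_ne_top (Set.union_subset (diff_subset x x')
    (Set.iUnion_subset fun i => diff_subset (y i) (y' i)))
  refine (measureReal_mono hsub hfin).trans ((measureReal_union_le _ _).trans ?_)
  exact add_le_add_right (measureReal_iUnion_fintype_le _) _

/-- The operad of step functions with values in an operad, whose topology is ignored. It has the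
same admissible sets, and its fixed point subspaces are empty or contractible. -/
noncomputable def GOperad.stepFun (O : GOperad G) : GOperad G where
  obj n := StepFun (O.obj n)
  one := StepFun.const O.one
  comp := StepFun.comp O
  continuous_comp {k j} := by
    have : LipschitzWith (1 + k) (fun p : StepFun (O.obj k) × ∀ i, StepFun (O.obj (j i)) =>
        StepFun.comp O p.1 p.2) := by
      refine LipschitzWith.of_dist_le_mul fun p q => (StepFun.dist_comp_le O _ _ _ _).trans ?_
      have h1 : dist p.1 q.1 ≤ dist p q := le_max_left _ _
      have h2 (i : Fin k) : dist (p.2 i) (q.2 i) ≤ dist p q :=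
        (dist_le_pi_dist p.2 q.2 i).trans (le_max_right _ _)
      have h3 := Finset.sum_le_sum fun i (_ : i ∈ Finset.univ) => h2 i
      rw [Finset.sum_const, Finset.card_univ, Fintype.card_fin, nsmul_eq_mul] at h3
      push_cast
      linarith
    exact continuous_le_dom compactlyGenerated_le this.continuous
  one_comp y := StepFun.sigma_eq fun t => O.one_comp fun i => y i t
  comp_one x := StepFun.sigma_eq fun t => O.comp_one (x t)
  assoc x y z := StepFun.sigma_eq fun t => O.assoc (x t) (fun i => y i t) fun i l => z i l t
  perm_comp σ x y := StepFun.ext fun t => by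
    rw [StepFun.relabel_apply]
    exact O.perm_comp σ (x t) fun i => y i t
  comp_perm τ x y := StepFun.ext fun t => O.comp_perm τ (x t) fun i => y i t
  smul_one g := StepFun.ext fun _ => O.smul_one g
  smul_comp g x y := StepFun.ext fun t => O.smul_comp g (x t) fun i => y i t

lemma isAdmissible_stepFun_iff (O : GOperad G) (H : Subgroup G) (T : Type u) (a : MulAction H T) :
    IsAdmissible O.stepFun H T a ↔ IsAdmissible O H T a := by
  rw [isAdmissible_iff, isAdmissible_iff]
  refine exists_congr fun n => exists_congr fun e => ⟨?_, ?_⟩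
  · rintro ⟨f, hf⟩
    exact ⟨f.1 ⟨0, by simp⟩, fun h => congrFun (congrArg StepFun.toFun (hf h)) _⟩
  · rintro ⟨x, hx⟩
    exact ⟨StepFun.const x, fun h => StepFun.ext fun _ => hx h⟩

lemma isNInfinity_stepFun (O : GOperad G)
    (hfree : ∀ (n : ℕ) (σ : Equiv.Perm (Fin n)) (x : O.obj n), ((1 : G), σ) • x = x → σ = 1)
    (hne : ∀ (n : ℕ) (H : Subgroup G),
      (MulAction.fixedPoints (H.prod (⊥ : Subgroup (Equiv.Perm (Fin n)))) (O.obj n)).Nonempty) :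
    IsNInfinity G O.stepFun where
  free n σ f h := hfree n σ (f.1 ⟨0, by simp⟩) (congrFun (congrArg StepFun.toFun h) _)
  empty_or_contractible n Λ := by
    refine or_iff_not_imp_left.mpr fun h => ?_
    obtain ⟨⟨f, hf⟩⟩ := not_isEmpty_iff.mp h
    have hx (l : Λ) : l • f.1 ⟨0, by simp⟩ = f.1 ⟨0, by simp⟩ :=
      congrFun (congrArg StepFun.toFun (hf l)) _
    refine StepFun.contractibleSpace (f.1 ⟨0, by simp⟩) (fun l => StepFun.ext fun _ => hx l)
      fun t f' hf' l => StepFun.ext fun s => ?_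
    have hf'' : l • f'.1 s = f'.1 s := congrFun (congrArg StepFun.toFun (hf' l)) s
    change l • StepFun.cut _ t f' s = StepFun.cut _ t f' s
    rcases lt_or_ge (s : ℝ) t with h | h
    · rw [StepFun.cut_of_lt _ _ h]
      exact hx l
    · rw [StepFun.cut_of_le _ _ h]
      exact hf''
  nonempty n H := by
    obtain ⟨x, hx⟩ := hne n H
    exact ⟨StepFun.const x, fun l => StepFun.ext fun _ => hx l⟩

end StepFunctions

/-! ### Numbering of letters in words of blocks -/

section BlockIndices

/-- The position of a letter in a word of blocks. -/
lemma finSigmaFinEquiv_val {k : ℕ} {n : Fin k → ℕ} (q : Σ i, Fin (n i)) :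
    (finSigmaFinEquiv q : ℕ) = ∑ i ∈ Finset.Iio q.1, n i + q.2 := by
  rw [finSigmaFinEquiv_apply]
  congr 1
  refine Finset.sum_bij (fun i _ => Fin.castLE q.1.2.le i) (fun i _ => ?_) (fun i _ i' _ h => ?_)
    (fun i hi => ?_) fun _ _ => rfl
  · exact Finset.mem_Iio.mpr i.2
  · exact Fin.castLE_injective _ h
  · exact ⟨⟨i, Fin.lt_def.mp (Finset.mem_Iio.mp hi)⟩, Finset.mem_univ _, rfl⟩

lemma finSigmaFinEquiv_lt_of_lt {k : ℕ} {n : Fin k → ℕ} {q q' : Σ i, Fin (n i)}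
    (h : q.1 < q'.1) : finSigmaFinEquiv q < finSigmaFinEquiv q' := by
  rw [Fin.lt_def, finSigmaFinEquiv_val, finSigmaFinEquiv_val]
  have h1 : insert q.1 (Finset.Iio q.1) ⊆ Finset.Iio q'.1 := by
    intro i hi
    rcases Finset.mem_insert.mp hi with rfl | hi
    · exact Finset.mem_Iio.mpr h
    · exact Finset.mem_Iio.mpr ((Finset.mem_Iio.mp hi).trans h)
  have h2 := Finset.sum_le_sum_of_subset (f := n) h1
  rw [Finset.sum_insert (by simp)] at h2
  have := q.2.2
  omega

lemma finSigmaFinEquiv_mk_lt {k : ℕ} {n : Fin k → ℕ} {i : Fin k} {l l' : Fin (n i)} :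
    finSigmaFinEquiv (⟨i, l⟩ : Σ i, Fin (n i)) < finSigmaFinEquiv ⟨i, l'⟩ ↔ l < l' := by
  rw [Fin.lt_def, finSigmaFinEquiv_val, finSigmaFinEquiv_val, Fin.lt_def]
  simp

lemma sum_Iio_finSigmaFinEquiv {k : ℕ} {j : Fin k → ℕ} (f : (Σ i, Fin (j i)) → ℕ)
    (q : Σ i, Fin (j i)) :
    ∑ a ∈ Finset.Iio (finSigmaFinEquiv q), f (finSigmaFinEquiv.symm a) =
      ∑ i ∈ Finset.Iio q.1, ∑ l, f ⟨i, l⟩ + ∑ l ∈ Finset.Iio q.2, f ⟨q.1, l⟩ := by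
  obtain ⟨i, l⟩ := q
  have hIio {n : ℕ} (f : Fin n → ℕ) (b : Fin n) :
      ∑ x ∈ Finset.Iio b, f x = ∑ x, if x < b then f x else 0 := by
    rw [← Finset.sum_filter]
    congr 1
    ext
    simp
  have hY : ∑ l' ∈ Finset.Iio l, f ⟨i, l'⟩ =
      ∑ i', if i' = i then ∑ l' ∈ Finset.Iio l, f ⟨i, l'⟩ else 0 := by
    rw [Finset.sum_ite_eq' Finset.univ i, if_pos (Finset.mem_univ i)]
  dsimp only
  rw [hIio, hIio, hY, ← Finset.sum_add_distrib, ← finSigmaFinEquiv.sum_comp, Fintype.sum_sigma]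
  refine Finset.sum_congr rfl fun i' _ => ?_
  simp only [Equiv.symm_apply_apply]
  rcases lt_trichotomy i' i with h | rfl | h
  · rw [if_pos h, if_neg h.ne, add_zero]
    exact Finset.sum_congr rfl fun l' _ => if_pos (finSigmaFinEquiv_lt_of_lt h)
  · rw [if_neg (lt_irrefl _), if_pos rfl, zero_add, hIio]
    exact Finset.sum_congr rfl fun l' _ => by simp only [finSigmaFinEquiv_mk_lt]
  · rw [if_neg h.not_gt, if_neg h.ne', add_zero]
    exact Finset.sum_eq_zero fun l' _ => if_neg (finSigmaFinEquiv_lt_of_lt h).not_gt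

/-- Associativity of the numbering of letters in words of blocks. -/
lemma finSigmaFinEquiv_assoc {k : ℕ} {j : Fin k → ℕ} (m : ∀ i, Fin (j i) → ℕ) (a : Fin (∑ i, j i))
    (p : Fin (m (finSigmaFinEquiv.symm a).1 (finSigmaFinEquiv.symm a).2)) :
    (finSigmaFinEquiv (⟨a, p⟩ : Σ a : Fin (∑ i, j i),
        Fin (m (finSigmaFinEquiv.symm a).1 (finSigmaFinEquiv.symm a).2)) : ℕ) =
      (finSigmaFinEquiv (⟨(finSigmaFinEquiv.symm a).1,
        finSigmaFinEquiv (⟨(finSigmaFinEquiv.symm a).2, p⟩ : Σ l, Fin (m _ l))⟩ :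
          Σ i, Fin (∑ l, m i l)) : ℕ) := by
  have h := sum_Iio_finSigmaFinEquiv (fun q => m q.1 q.2) (finSigmaFinEquiv.symm a)
  rw [Equiv.apply_symm_apply] at h
  rw [finSigmaFinEquiv_val, finSigmaFinEquiv_val, finSigmaFinEquiv_val, ← add_assoc]
  exact congrArg (· + (p : ℕ)) h

end BlockIndices

/-! ### Free operads -/

section Terms

universe v w

/-- An equivariant signature: for every arity `k` a `G`-set of operation symbols, together with
an action of `G`, covering the action on symbols, on their inputs `1, …, k`. The element `g`
carries the input `i` of `b` to the input `inputs g b i` of `g • b`. -/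
structure Signature (G : Type u) [Group G] where
  symb : ℕ → Type u
  [act : ∀ k, MulAction G (symb k)]
  inputs : ∀ {k : ℕ}, G → symb k → Equiv.Perm (Fin k)
  inputs_mul : ∀ {k : ℕ} (g h : G) (b : symb k),
    inputs (g * h) b = inputs g (h • b) * inputs h b

attribute [instance] Signature.act

variable {G : Type u} [Group G] (S : Signature G)

lemma Signature.inputs_one {k : ℕ} (b : S.symb k) : S.inputs 1 b = 1 := by
  have := S.inputs_mul 1 1 b
  rwa [one_smul, mul_one, left_eq_mul] at this

/-- Terms in the operations of a signature with variables in `A`: planar trees with inner vertices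
labelled by operation symbols and leaves labelled by variables. -/
inductive Term (A : Type v) : Type (max u v)
  | leaf (a : A) : Term A
  | node (k : ℕ) (b : S.symb k) (ts : Fin k → Term A) : Term A

namespace Term

variable {S} {A : Type v} {B : Type w}

/-- Substitution of terms for variables. -/
def bind {B : Type w} : Term S A → (A → Term S B) → Term S B
  | leaf a, f => f a
  | node k b ts, f => node k b fun i => (ts i).bind f

/-- Renaming of variables. -/
def map (f : A → B) (t : Term S A) : Term S B := t.bind fun a => leaf (f a)

/-- The multiset of the variables of a term. -/
def vars : Term S A → Multiset A
  | leaf a => {a}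
  | node _ _ ts => ∑ i, (ts i).vars

/-- The action of an element of `G`, which acts on symbols and on their inputs. -/
def act (g : G) : Term S A → Term S A
  | leaf a => leaf a
  | node k b ts => node k (g • b) fun i => (ts ((S.inputs g b)⁻¹ i)).act g

lemma bind_bind {C : Type*} (t : Term S A) (f : A → Term S B) (f' : B → Term S C) :
    (t.bind f).bind f' = t.bind fun a => (f a).bind f' := by
  induction t with
  | leaf a => rfl
  | node k b ts ih => exact congrArg (node k b) (funext ih)

lemma bind_leaf (t : Term S A) : t.bind leaf = t := by
  induction t with
  | leaf a => rfl
  | node k b ts ih => exact congrArg (node k b) (funext ih)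

lemma map_bind {C : Type*} (t : Term S A) (f : A → Term S B) (f' : B → C) :
    (t.bind f).map f' = t.bind fun a => (f a).map f' := bind_bind _ _ _

lemma bind_map {C : Type*} (t : Term S A) (f : A → B) (f' : B → Term S C) :
    (t.map f).bind f' = t.bind fun a => f' (f a) := bind_bind _ _ _

lemma map_map {C : Type*} (t : Term S A) (f : A → B) (f' : B → C) :
    (t.map f).map f' = t.map fun a => f' (f a) := bind_bind _ _ _

lemma map_id (t : Term S A) : t.map (fun a => a) = t := bind_leaf t

lemma vars_bind (t : Term S A) (f : A → Term S B) :
    (t.bind f).vars = t.vars.bind fun a => (f a).vars := by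
  induction t with
  | leaf a => simp [bind, vars]
  | node k b ts ih =>
    simp only [bind, vars, ih]
    let φ : Multiset A →+ Multiset B :=
      ⟨⟨fun s => s.bind fun a => (f a).vars, Multiset.zero_bind _⟩,
        fun s s' => Multiset.add_bind s s' _⟩
    exact (map_sum φ _ _).symm

lemma vars_map (t : Term S A) (f : A → B) : (t.map f).vars = t.vars.map f := by
  rw [map, vars_bind]
  exact Multiset.bind_singleton _ _

lemma vars_act (g : G) (t : Term S A) : (t.act g).vars = t.vars := by
  induction t with
  | leaf a => rfl
  | node k b ts ih =>
    simp only [act, vars, ih]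
    exact Equiv.sum_comp (S.inputs g b)⁻¹ fun i => (ts i).vars

instance : MulAction G (Term S A) where
  smul := act
  one_smul t := by
    change t.act 1 = t
    induction t with
    | leaf a => rfl
    | node k b ts ih =>
      rw [act, S.inputs_one, one_smul]
      exact congrArg (node k b) (funext fun i => ih i)
  mul_smul g h t := by
    change t.act (g * h) = (t.act h).act g
    induction t with
    | leaf a => rfl
    | node k b ts ih =>
      rw [act, act, act, S.inputs_mul, mul_smul, mul_inv_rev]
      exact congrArg (node k _) (funext fun i => ih _)

lemma smul_node (g : G) {k : ℕ} (b : S.symb k) (ts : Fin k → Term S A) :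
    g • node k b ts = node k (g • b) fun i => g • ts ((S.inputs g b)⁻¹ i) := rfl

lemma vars_smul (g : G) (t : Term S A) : (g • t).vars = t.vars := vars_act g t

lemma smul_bind (g : G) (t : Term S A) (f : A → Term S B) :
    g • t.bind f = (g • t).bind fun a => g • f a := by
  induction t with
  | leaf a => rfl
  | node k b ts ih =>
    rw [bind, smul_node, smul_node, bind]
    exact congrArg (node k _) (funext fun i => ih _)

lemma smul_map (g : G) (t : Term S A) (f : A → B) : g • t.map f = (g • t).map f := smul_bind _ _ _

/-- Terms are planar, so that a renaming which preserves a term fixes its variables. -/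
lemma eq_of_map_eq {f : A → A} {t : Term S A} (h : t.map f = t) {a : A} (ha : a ∈ t.vars) :
    f a = a := by
  induction t with
  | leaf b =>
    obtain rfl : a = b := Multiset.mem_singleton.mp ha
    exact leaf.inj h
  | node k b ts ih =>
    obtain ⟨i, _, hi⟩ := Multiset.mem_sum.mp ha
    obtain ⟨_, _, hts⟩ := node.inj h
    exact ih i (congrFun (eq_of_heq hts) i) hi

end Term

/-- The terms in which each of the variables `1, …, n` occurs exactly once. -/
def LinearTerm (n : ℕ) : Type u := {t : Term S (Fin n) // t.vars = Finset.univ.val}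

namespace LinearTerm

variable {S}

instance (n : ℕ) : TopologicalSpace (LinearTerm S n) := ⊥

instance (n : ℕ) : DiscreteTopology (LinearTerm S n) := ⟨rfl⟩

lemma univ_val_map {α β : Type*} [Fintype α] [Fintype β] (e : α ≃ β) :
    (Finset.univ : Finset α).val.map e = Finset.univ.val := by
  rw [← Finset.map_univ_equiv e]
  rfl

instance (n : ℕ) : MulAction (G × Equiv.Perm (Fin n)) (LinearTerm S n) where
  smul g t := ⟨g.1 • t.1.map g.2, by rw [Term.vars_smul, Term.vars_map, t.2, univ_val_map]⟩
  one_smul t := Subtype.ext ((one_smul G _).trans t.1.map_id)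
  mul_smul g h t := Subtype.ext (by
    change (g.1 * h.1) • t.1.map (g.2 * h.2) = g.1 • (h.1 • t.1.map h.2).map g.2
    rw [mul_smul, ← Term.smul_map, Term.map_map]
    rfl)

lemma coe_perm_smul {n : ℕ} (σ : Equiv.Perm (Fin n)) (t : LinearTerm S n) :
    (((1 : G), σ) • t).1 = t.1.map σ := one_smul G _

lemma coe_one_smul {n : ℕ} (g : G) (t : LinearTerm S n) :
    ((g, (1 : Equiv.Perm (Fin n))) • t).1 = g • t.1 := congrArg (g • ·) t.1.map_id

lemma coe_relabel {m n : ℕ} (e : Fin m ≃ Fin n) (t : LinearTerm S m) :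
    (relabel G (LinearTerm S) e t).1 = t.1.map e := by
  obtain rfl : m = n := Fin.equiv_iff_eq.mp ⟨e⟩
  exact coe_perm_smul e t

lemma sigma_eq {m n : ℕ} (h : m = n) {s : LinearTerm S m} {t : LinearTerm S n}
    (hst : s.1.map (Fin.cast h) = t.1) : (⟨m, s⟩ : Σ n, LinearTerm S n) = ⟨n, t⟩ := by
  subst h
  exact congrArg (Sigma.mk m) (Subtype.ext (s.1.map_id.symm.trans hst))

instance (n : ℕ) : ContinuousConstSMul (G × Equiv.Perm (Fin n)) (LinearTerm S n) :=
  ⟨fun _ => continuous_of_discreteTopology⟩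

/-- Simultaneous substitution of terms in disjoint sets of variables. -/
def comp {k : ℕ} {j : Fin k → ℕ} (x : LinearTerm S k) (y : ∀ i, LinearTerm S (j i)) :
    LinearTerm S (∑ i, j i) :=
  ⟨x.1.bind fun i => (y i).1.map fun l => finSigmaFinEquiv ⟨i, l⟩, by
    rw [Term.vars_bind, x.2]
    simp only [Term.vars_map, fun i => (y i).2]
    have h : (Finset.univ : Finset (Σ i, Fin (j i))).val =
        Finset.univ.val.bind fun i => Finset.univ.val.map (Sigma.mk i) := rfl
    rw [← univ_val_map (finSigmaFinEquiv (n := j)), h, Multiset.map_bind]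
    simp only [Multiset.map_map, Function.comp_def]⟩

lemma coe_comp {k : ℕ} {j : Fin k → ℕ} (x : LinearTerm S k) (y : ∀ i, LinearTerm S (j i)) :
    (comp x y).1 = x.1.bind fun i => (y i).1.map fun l => finSigmaFinEquiv ⟨i, l⟩ := rfl

variable (S) in
/-- The free operad on an equivariant signature, with the discrete topology. -/
def operad : GOperad G where
  obj := LinearTerm S
  one := ⟨Term.leaf 0, rfl⟩
  comp := comp
  continuous_comp := continuous_le_dom compactlyGenerated_le continuous_of_discreteTopology
  one_comp {j} y := by
    refine sigma_eq (Fin.sum_univ_one j) ?_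
    refine (Term.map_map _ _ _).trans (Eq.trans ?_ (y 0).1.map_id)
    refine congrArg (Term.map · (y 0).1) (funext fun l => Fin.ext ?_)
    simp
  comp_one {k} x := by
    refine sigma_eq (by simp) ?_
    refine (Term.map_bind _ _ _).trans (Eq.trans ?_ x.1.bind_leaf)
    refine congrArg x.1.bind (funext fun i => congrArg Term.leaf (Fin.ext ?_))
    simp
  assoc {k j m} x y z := by
    refine sigma_eq ?_ ?_
    · rw [finSigmaFinEquiv.symm.sum_comp fun q : Σ i, Fin (j i) => m q.1 q.2, Fintype.sum_sigma]
    · rw [coe_comp, coe_comp, coe_comp, Term.bind_bind, Term.map_bind]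
      refine congrArg x.1.bind (funext fun i => ?_)
      rw [Term.bind_map, coe_comp, Term.map_bind, Term.map_bind]
      refine congrArg (y i).1.bind (funext fun l => ?_)
      have key (a : Fin (∑ i, j i)) (q : Σ i, Fin (j i)) (hq : finSigmaFinEquiv.symm a = q)
          (h : ∑ a : Fin (∑ i, j i), m (finSigmaFinEquiv.symm a).1 (finSigmaFinEquiv.symm a).2 =
            ∑ i, ∑ l, m i l) :
          ((z (finSigmaFinEquiv.symm a).1 (finSigmaFinEquiv.symm a).2).1.map
            fun p => finSigmaFinEquiv ⟨a, p⟩).map (Fin.cast h) =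
          ((z q.1 q.2).1.map fun p => finSigmaFinEquiv ⟨q.2, p⟩).map
            fun p => finSigmaFinEquiv (⟨q.1, p⟩ : Σ i, Fin (∑ l, m i l)) := by
        subst hq
        rw [Term.map_map, Term.map_map]
        refine congrArg (Term.map · _) (funext fun p => Fin.ext ?_)
        exact finSigmaFinEquiv_assoc m a p
      exact key _ ⟨i, l⟩ (Equiv.symm_apply_apply _ _) _
  perm_comp {k j} σ x y := by
    refine Subtype.ext ?_
    rw [coe_relabel, coe_comp, coe_perm_smul, Term.bind_map, coe_comp, Term.map_bind]
    refine congrArg x.1.bind (funext fun i => ?_)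
    rw [Term.map_map]
    exact congrArg (Term.map · _) (funext fun l => (blockPerm_apply σ i l).symm)
  comp_perm {k j} τ x y := by
    refine Subtype.ext ?_
    rw [coe_perm_smul, coe_comp, coe_comp, Term.map_bind]
    refine congrArg x.1.bind (funext fun i => ?_)
    rw [coe_perm_smul, Term.map_map, Term.map_map]
    exact congrArg (Term.map · _) (funext fun l =>
      (blockEquiv_apply (j := j) (j' := j) (Equiv.refl _) τ i l).symm)
  smul_one g := rfl
  smul_comp {k j} g x y := by
    refine Subtype.ext ?_
    rw [coe_one_smul, coe_comp, coe_comp, coe_one_smul, Term.smul_bind]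
    refine congrArg (Term.bind _) (funext fun i => ?_)
    rw [coe_one_smul, Term.smul_map]

lemma eq_one_of_smul_eq {n : ℕ} {σ : Equiv.Perm (Fin n)} {t : LinearTerm S n}
    (h : ((1 : G), σ) • t = t) : σ = 1 := by
  ext i
  have h' := congrArg Subtype.val h
  rw [coe_perm_smul] at h'
  rw [Term.eq_of_map_eq h' (a := i) (by rw [t.2]; exact Finset.mem_univ i)]
  rfl

end LinearTerm

end Terms

/-! ### Admissible sets of free operads -/

section FixedTerms

variable {G : Type u} [Group G] (S : Signature G)

/-- The action on the inputs of an operation symbol of a subgroup that fixes the symbol. -/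
@[reducible] def inputAction {k : ℕ} (b : S.symb k) (K : Subgroup G)
    (hK : ∀ g : K, (g : G) • b = b) : MulAction K (ULift.{u} (Fin k)) where
  smul g i := ⟨S.inputs g b i.down⟩
  one_smul i := by
    refine ULift.ext _ _ ?_
    change S.inputs 1 b i.down = i.down
    rw [S.inputs_one]
    rfl
  mul_smul g h i := by
    refine ULift.ext _ _ ?_
    change S.inputs (g * h) b i.down = S.inputs g b (S.inputs h b i.down)
    rw [S.inputs_mul, hK]
    rfl

/-- A signature belongs to an indexing system if the sets of inputs of its symbols do. -/
def Signature.BelongsTo (F : IndexingSystem G) : Prop :=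
  ∀ (k : ℕ) (b : S.symb k) (K : Subgroup G) (hK : ∀ g : K, (g : G) • b = b),
    F.mem K (ULift (Fin k)) (inputAction S b K hK)

variable {S}

/-- Let the term `t` without repeated variables be invariant under a simultaneous action of `H` on
operations and variables. Then the variables of `t` form an admissible `H`-set: they map to
the inputs of the operation at the root, and the fibres are the sets of variables of subterms. -/
lemma Term.mem_of_smul_map_eq {F : IndexingSystem G} (hS : S.BelongsTo F) {A : Type u}
    (t : Term S A) (ht : t.vars.Nodup) {H : Subgroup G} [a : MulAction H A]
    (hH : ∀ h : H, (h : G) • t.map (h • ·) = t) {Y : Type u} [c : MulAction H Y] (f : Y → A)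
    (hf : Function.Injective f) (hfe : ∀ (h : H) (y : Y), f (h • y) = h • f y)
    (hft : ∀ y, f y ∈ t.vars) (hfs : ∀ x ∈ t.vars, x ∈ Set.range f) : F.mem H Y c := by
  induction t generalizing H Y with
  | leaf x =>
    have hx (y : Y) : f y = x := Multiset.mem_singleton.mp (hft y)
    have : Subsingleton Y := ⟨fun y y' => hf ((hx y).trans (hx y').symm)⟩
    exact F.trivial_mem H Y c inferInstance fun _ _ => Subsingleton.elim _ _
  | node k b ts ih =>
    have hb (h : H) : (h : G) • b = b := eq_of_heq (Term.node.inj (hH h)).2.1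
    have hts (h : H) (i : Fin k) :
        (h : G) • (ts ((S.inputs h b)⁻¹ i)).map (h • ·) = ts i :=
      congrFun (eq_of_heq (Term.node.inj (hH h)).2.2) i
    have hle (i : Fin k) : (ts i).vars ≤ (Term.node k b ts).vars :=
      Finset.single_le_sum (fun i _ => Multiset.zero_le _) (Finset.mem_univ i)
    have huniq {x : A} {i i' : Fin k} (hi : x ∈ (ts i).vars) (hi' : x ∈ (ts i').vars) :
        i = i' := by
      by_contra hne
      have h1 : (ts i).vars + (ts i').vars ≤ (Term.node k b ts).vars := by
        rw [← Finset.sum_pair (f := fun i => (ts i).vars) hne]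
        exact Finset.sum_le_sum_of_subset (Finset.subset_univ _)
      exact Multiset.disjoint_left.mp (Multiset.nodup_add.mp (Multiset.nodup_of_le h1 ht)).2.2
        hi hi'
    have hex (y : Y) : ∃ i, f y ∈ (ts i).vars := by
      obtain ⟨i, _, hi⟩ := Multiset.mem_sum.mp (hft y)
      exact ⟨i, hi⟩
    choose p hp using hex
    let d : MulAction H (ULift.{u} (Fin k)) := inputAction S b H hb
    let P : Y → ULift.{u} (Fin k) := fun y => ⟨p y⟩
    have hP (h : H) (y : Y) : P (h • y) = h • P y := by
      refine ULift.ext _ _ (huniq (hp (h • y)) ?_)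
      rw [hfe]
      change h • f y ∈ (ts (S.inputs h b (p y))).vars
      rw [← hts h, Term.vars_smul, Term.vars_map,
        show (S.inputs (h : G) b)⁻¹ (S.inputs (h : G) b (p y)) = p y from Equiv.symm_apply_apply _ _]
      exact Multiset.mem_map_of_mem _ (hp y)
    refine F.isClosedUnderExtensions H Y _ c d P hP (hS k b H hb) fun i => ?_
    rw [show i = (1 : H) • i from (one_smul H i).symm]
    refine ⟨1, stab H i, stab_le H i, _, fibreAction hP i, Subtype.val, ?_, ?_⟩
    · rw [one_smul, one_smul]
      exact isFibre_fibreAction hP i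
    · let a' : MulAction (stab H i) A := resAction (stab_le H i) a
      let c' := fibreAction hP i
      refine ih i.down (Multiset.nodup_of_le (hle _) ht) (H := stab H i) (fun h => ?_)
        (fun y => f y.1) (hf.comp Subtype.val_injective) (fun h y => hfe _ y.1) (fun y => ?_)
        fun x hx => ?_
      · have h1 := hts (Subgroup.inclusion (stab_le H i) h) i.down
        have h2 := (smul_eq_iff_mem_stab i (Subgroup.inclusion (stab_le H i) h)).mpr h.2
        have h3 : S.inputs (h : G) b i.down = i.down := congrArg ULift.down h2
        have h4 : (S.inputs (h : G) b)⁻¹ i.down = i.down := by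
          rw [Equiv.Perm.inv_eq_iff_eq, h3]
        change (h : G) • (ts ((S.inputs (h : G) b)⁻¹ i.down)).map _ = _ at h1
        rw [h4] at h1
        exact h1
      · have := hp y.1
        rwa [show p y.1 = i.down from congrArg ULift.down y.2] at this
      · obtain ⟨y, rfl⟩ := hfs x (Multiset.mem_of_le (hle _) hx)
        exact ⟨⟨y, ULift.ext _ _ (huniq (hp y) hx)⟩, rfl⟩

/-- The admissible sets of the free operad on a signature in an indexing system belong to it. -/
lemma mem_of_isAdmissible_operad {F : IndexingSystem G} (hS : S.BelongsTo F) {H : Subgroup G}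
    {T : Type u} {a : MulAction H T} (h : IsAdmissible (LinearTerm.operad S) H T a) :
    F.mem H T a := by
  obtain ⟨n, e, x, hx⟩ := (isAdmissible_iff _ a).mp h
  let x' : LinearTerm S n := x
  have hv : (x'.1.map e.symm).vars = (Finset.univ : Finset (Fin n)).val.map e.symm := by
    rw [Term.vars_map, x'.2]
  refine Term.mem_of_smul_map_eq hS (x'.1.map e.symm) ?_ (fun h => ?_) id
    Function.injective_id (fun _ _ => rfl) (fun t => ?_) fun t _ => ⟨t, rfl⟩
  · rw [hv]
    exact Finset.univ.nodup.map e.symm.injective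
  · have h1 : (h : G) • x'.1.map (permRep e h) = x'.1 := congrArg Subtype.val (hx h)
    conv_rhs => rw [← h1]
    rw [← Term.smul_map, Term.map_map, Term.map_map]
    refine congrArg (fun f => (h : G) • x'.1.map f) (funext fun i => ?_)
    obtain ⟨t, rfl⟩ := e.surjective i
    rw [permRep_apply, Equiv.symm_apply_apply, Equiv.symm_apply_apply]
  · rw [hv]
    exact Multiset.mem_map.mpr ⟨e t, Finset.mem_val.mpr (Finset.mem_univ _), e.symm_apply_apply t⟩

end FixedTerms

/-! ### Realization of indexing systems -/

section Realization

variable {G : Type u} [Group G]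

/-- The element of `H` by which `g` moves the chosen representative of the coset `q` to the chosen
representative of the coset `g • q`. -/
noncomputable def cosetCocycle (H : Subgroup G) (g : G) (q : G ⧸ H) : H :=
  ⟨(g • q).out⁻¹ * (g * q.out), by
    rw [← QuotientGroup.eq, QuotientGroup.out_eq', ← smul_eq_mul, ← MulAction.Quotient.smul_coe,
      QuotientGroup.out_eq']⟩

lemma cosetCocycle_mul (H : Subgroup G) (g h : G) (q : G ⧸ H) :
    cosetCocycle H (g * h) q = cosetCocycle H g (h • q) * cosetCocycle H h q := by
  refine Subtype.ext ?_
  simp [cosetCocycle, mul_smul, mul_assoc]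

lemma coe_cosetCocycle_of_smul_eq {H : Subgroup G} {g : G} {q : G ⧸ H} (h : g • q = q) :
    (cosetCocycle H g q : G) = q.out⁻¹ * (g * q.out) := by
  simp [cosetCocycle, h]

/-- The `H`-set `{1, …, k}` with the action given by `α`. -/
@[reducible] def permAction {H : Subgroup G} {k : ℕ} (α : H →* Equiv.Perm (Fin k)) :
    MulAction H (ULift.{u} (Fin k)) :=
  MulAction.compHom _ α

/-- The signature of an indexing system: for every permutation representation `α : H → Σ_k` in the
system, the operation symbols form an orbit `G / H`, and the stabilizer `H` of the base point
acts on the inputs through (a conjugate of) `α`. -/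
noncomputable def IndexingSystem.signature (F : IndexingSystem G) : Signature G where
  symb k := Σ α : {α : Σ H : Subgroup G, H →* Equiv.Perm (Fin k) //
    F.mem α.1 (ULift (Fin k)) (permAction α.2)}, G ⧸ α.1.1
  inputs g b := b.1.1.2 (cosetCocycle b.1.1.1 g b.2)
  inputs_mul g h b := by
    rw [cosetCocycle_mul, map_mul]
    rfl

lemma IndexingSystem.belongsTo_signature (F : IndexingSystem G) :
    F.signature.BelongsTo F := by
  rintro k ⟨⟨⟨H, α⟩, hα⟩, q⟩ K hK
  have hq (g : K) : (g : G) • q = q := by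
    have := hK g
    exact eq_of_heq (Sigma.mk.inj this).2
  have hle : K ≤ H.map (MulAut.conj q.out).toMonoidHom := by
    intro g hg
    refine ⟨cosetCocycle H g q, (cosetCocycle H g q).2, ?_⟩
    rw [coe_cosetCocycle_of_smul_eq (hq ⟨g, hg⟩)]
    simp [mul_assoc]
  refine F.iso_mem K _ _ _ _ (Equiv.refl _) ?_
    (F.res_mem K _ hle _ _ (F.conj_mem H _ (permAction α) q.out hα))
  rintro g i
  let φ := H.equivMapOfInjective (MulAut.conj q.out).toMonoidHom (MulAut.conj q.out).injective
  have hφ : φ.symm (Subgroup.inclusion hle g) = cosetCocycle H g q := by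
    rw [MulEquiv.symm_apply_eq]
    refine Subtype.ext ?_
    change (g : G) = q.out * cosetCocycle H g q * q.out⁻¹
    rw [coe_cosetCocycle_of_smul_eq (hq g)]
    group
  exact congrArg (fun h => ULift.up (α h i.down)) hφ

/-- The sets of an indexing system are admissible for the free operad on its signature: the
corollas on the operation symbols have the required symmetry. -/
lemma IndexingSystem.isAdmissible_operad (F : IndexingSystem G) {H : Subgroup G} {T : Type u}
    {a : MulAction H T} (hT : F.mem H T a) :
    IsAdmissible (LinearTerm.operad F.signature) H T a := by
  have := F.finite H T a hT
  obtain ⟨n, ⟨e⟩⟩ := Finite.exists_equiv_fin T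
  let α : H →* Equiv.Perm (Fin n) := permRep e
  have hα : F.mem H (ULift (Fin n)) (permAction α) :=
    F.iso_mem H T _ a _ (e.trans Equiv.ulift.symm)
      (fun h t => congrArg ULift.up (permRep_apply e h t).symm) hT
  let q : G ⧸ H := ((1 : G) : G ⧸ H)
  let b : F.signature.symb n := ⟨⟨⟨H, α⟩, hα⟩, q⟩
  have hr : (q.out : G) ∈ H := by
    have := QuotientGroup.eq.mp (show ((1 : G) : G ⧸ H) = (q.out : G) from
      (QuotientGroup.out_eq' q).symm)
    simpa using this
  -- The chosen representative `r` of the coset `H` may differ from `1`, so that the symbol `b`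
  -- has the representation `α` conjugated by `α r`, which the numbering of the leaves undoes.
  let r : H := ⟨q.out, hr⟩
  let t : Term F.signature (Fin n) := Term.node n b fun i => Term.leaf (α r i)
  have ht : t.vars = Finset.univ.val :=
    (Equiv.sum_comp (α r) fun i => ({i} : Multiset (Fin n))).trans
      (Finset.sum_multiset_singleton _)
  refine (isAdmissible_iff _ a).mpr ⟨n, e, (⟨t, ht⟩ : LinearTerm F.signature n), fun h => ?_⟩
  refine Subtype.ext ?_
  change (h : G) • t.map (α h) = t
  have hq : (h : G) • q = q := by
    change (((h : G) * 1 : G) : G ⧸ H) = ((1 : G) : G ⧸ H)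
    rw [QuotientGroup.eq]
    simp
  have hb : (h : G) • b = b := congrArg (Sigma.mk _) hq
  have hc : F.signature.inputs (h : G) b = α (r⁻¹ * (h * r)) := by
    refine congrArg α (Subtype.ext ?_)
    rw [coe_cosetCocycle_of_smul_eq hq]
    rfl
  change Term.node n ((h : G) • b)
    (fun i => Term.leaf (α h (α r ((F.signature.inputs (h : G) b)⁻¹ i)))) = _
  rw [hb, hc]
  refine congrArg (Term.node n b) (funext fun i => congrArg Term.leaf ?_)
  rw [← map_inv, ← Equiv.Perm.mul_apply, ← Equiv.Perm.mul_apply, ← map_mul, ← map_mul]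
  congr 2
  group

/-- Every indexing system is the system of admissible sets of an `N_∞` operad. -/
lemma admissibleFunctor_obj_surjective : Function.Surjective (admissibleFunctor G).obj := by
  intro F
  let L := LinearTerm.operad F.signature
  have hL (H : Subgroup G) (T : Type u) (a : MulAction H T) : IsAdmissible L H T a ↔ F.mem H T a :=
    ⟨mem_of_isAdmissible_operad F.belongsTo_signature, F.isAdmissible_operad⟩
  have hN : IsNInfinity G L.stepFun := by
    refine isNInfinity_stepFun L (fun _ _ _ => LinearTerm.eq_one_of_smul_eq) fun n H => ?_
    let a : MulAction H (ULift.{u} (Fin n)) := permAction 1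
    have ha := (hL H _ a).mpr (F.trivial_mem H _ a inferInstance fun _ _ => rfl)
    obtain ⟨x, hx⟩ := ha.exists_smul_eq Equiv.ulift
    refine ⟨x, ?_⟩
    rintro ⟨⟨g, σ⟩, hg, hσ⟩
    obtain rfl : σ = 1 := hσ
    have h1 := hx ⟨g, hg⟩
    rwa [permRep_eq _ _ 1 fun _ => rfl] at h1
  refine ⟨⟨L.stepFun, hN⟩, le_antisymm ?_ ?_⟩
  · exact fun H T a h => (hL H T a).mp ((isAdmissible_stepFun_iff L H T a).mp h)
  · exact fun H T a h => (isAdmissible_stepFun_iff L H T a).mpr ((hL H T a).mpr h)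

end Realization

end NInfinity

theorem mainTheorem2 (G : Type u) [Group G] [Finite G] :
    ∃ (A : NInfinity.NInfOperad G ⥤ NInfinity.IndexingSystem G)
      (hA : (NInfinity.weakEquivalences G).IsInvertedBy A),
      (∀ (O : NInfinity.NInfOperad G) (H : Subgroup G) (T : Type u) (a : MulAction H T),
        (A.obj O).mem H T a ↔ NInfinity.IsAdmissible O.obj H T a) ∧
      (Localization.Construction.lift A hA :
        NInfinity.HoNInfOperad G ⥤ NInfinity.IndexingSystem G).IsEquivalence :=
  ⟨NInfinity.admissibleFunctor G, NInfinity.isInvertedBy_admissibleFunctor,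
    fun _ _ _ _ => Iff.rfl,
    (NInfinity.nInfinityProducts G).isEquivalence_lift _ NInfinity.weakEquivalences_fst
      NInfinity.isInvertedBy_admissibleFunctor NInfinity.admissibleFunctor_obj_surjective⟩
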